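/- All graphs are finite and undirected; parallel edges are allowed, loops are not. A cycle consists of $n \ge 2$ distinct vertices $v_0,\dots,v_{n-1}$ and $n$ distinct edges $e_0,\dots,e_{n-1}$, where $e_i$ joins $v_i$ and $v_{i+1}$ (indices modulo $n$); for $n=2$ it is a pair of parallel edges. A length-function on a graph $G$ is a map $\ell : E(G) \to \mathbb{R}$ with $\ell(e) > 0$ for every edge $e$, and for a subgraph $H \subseteq G$ put $\ell(H) := \sum_{e \in E(H)} \ell(e)$. For $A \subseteq V(G)$, the Steiner distance $\mathrm{sd}_G(A)$ is the minimum of $\ell(S)$ over all connected subgraphs $S \subseteq G$ with $A \subseteq V(S)$, and $\mathrm{sd}_G(A) := \infty$ if there is no such subgraph. A subgraph $H \subseteq G$ (with the length-function $\ell|_{E(H)}$) is $k$-geodesic in $G$ if $\mathrm{sd}_H(A) = \mathrm{sd}_G(A)$ for every $A \subseteq V(H)$ with $|A| \le k$, and fully geodesic in $G$ if it is $k$-geodesic in $G$ for every $k \in \mathbb{N}$. **Theorem.** Let $G$ be a graph with length-function $\ell$ and let $C \subseteq G$ be a cycle. If $C$ is $6$-geodesic in $G$, then $C$ is fully geodesic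 in $G$. Moreover, the number $6$ cannot be replaced by any smaller integer: for every natural number $k < 6$ there are a graph $G$ with a length-function $\ell$ and a cycle $C \subseteq G$ such that $C$ is $k$-geodesic in $G$ but not fully geodesic in $G$. -/

import Mathlib

open scoped Graph

namespace SteinerGeodesic

/-- A (multi)graph is connected if it is non-empty and any two of its vertices are joined by
a walk. -/
def Connected {α β : Type*} (G : Graph α β) : Prop :=
  V(G).Nonempty ∧ ∀ x ∈ V(G), ∀ y ∈ V(G), Relation.ReflTransGen G.Adj x y

/-- A cycle: `n ≥ 2` distinct vertices `v i` and `n` distinct edges `e i`, indexed cyclically,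
where `e i` joins `v i` to `v (i + 1)`. For `n = 2` this is a pair of parallel edges. -/
def IsCycle {α β : Type*} (C : Graph α β) : Prop :=
  ∃ n : ℕ, 2 ≤ n ∧ ∃ (v : ZMod n → α) (e : ZMod n → β),
    Function.Injective v ∧ Function.Injective e ∧
    V(C) = Set.range v ∧ E(C) = Set.range e ∧
    ∀ i, C.IsLink (e i) (v i) (v (i + 1))

/-- A length-function on `G` assigns a positive real number to every edge of `G`
(its values outside `E(G)` are irrelevant). -/
def IsLengthFunction {α β : Type*} (G : Graph α β) (ℓ : β → ℝ) : Prop :=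
  ∀ e ∈ E(G), 0 < ℓ e

/-- The length of a finite graph: the sum of the lengths of its edges. -/
noncomputable def length {α β : Type*} (ℓ : β → ℝ) (H : Graph α β) : ℝ :=
  ∑ᶠ e ∈ E(H), ℓ e

/-- The Steiner distance of `A` in `G`: the infimum (a minimum when `G` is finite and `A` lies in
some connected subgraph) of the lengths of the connected subgraphs of `G` containing `A`;
it is `⊤` if there is no such subgraph. -/
noncomputable def steinerDist {α β : Type*} (ℓ : β → ℝ) (G : Graph α β) (A : Set α) : EReal :=
  sInf {r | ∃ S : Graph α β, S ≤ G ∧ Connected S ∧ A ⊆ V(S) ∧ r = ((length ℓ S : ℝ) : EReal)}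

/-- `H` is `k`-geodesic in `G` (for a subgraph `H ≤ G` of a finite graph `G`). -/
def IsGeodesic {α β : Type*} (ℓ : β → ℝ) (k : ℕ) (H G : Graph α β) : Prop :=
  ∀ A : Finset α, (A : Set α) ⊆ V(H) → A.card ≤ k →
    steinerDist ℓ H (A : Set α) = steinerDist ℓ G (A : Set α)

/-- `H` is fully geodesic in `G`: it is `k`-geodesic for every natural number `k`. -/
def IsFullyGeodesic {α β : Type*} (ℓ : β → ℝ) (H G : Graph α β) : Prop :=
  ∀ k : ℕ, IsGeodesic ℓ k H G

end SteinerGeodesic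

/-! Take a smallest set `A` of cycle vertices that some tree in `G` joins at cost `t` while the
cycle `C` does not. If `C` is 6-geodesic then `|A| ≥ 7`, and every proper subset of `A` is joined in
`C` as cheaply as in `G`. By repeated Dreyfus–Wagner splitting (`exists_splitsAt`), the tree divides
at a vertex into two subtrees whose terminal sets `X` and `X'` each have at least three elements.
Each subtree splits twice more, which gives three branches on either side
(`Joined.exists_three_branches`).

Two complementary parts of `A` with separate costs summing to at most `t` cannot interleave on `C`:
an arc system joining one would meet the other, and the union would join `A` (`Frame.not_crossing`).
Hence the branches lie on `C` in a planar cyclic order. The costs of several partial unions,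
transferred to `C`, then force `X` to be strictly cheaper to join in `C` than `X'`
(`FiveBranch.exists_lt`). This inequality uses two branches of the `X` side and three of the `X'`
side. Since both sides have three branches, the roles can be exchanged, giving the reverse strict
inequality and a contradiction.

For sharpness, a six-cycle with a tree on its vertices serves every `k < 6`. The tree has length 45,
and the cycle needs 62 - 16 = 46 to join all six vertices. A table of lower bounds for tree lengths,
checked by computation, shows that every proper subset is joined optimally by an arc. -/

namespace SteinerGeodesic

open Relation

/-! ### Edge sets joining vertices, rooted trees and their relation to Steiner distance -/

section Joined

variable {α β : Type*} {G H C : Graph α β} {ℓ : β → ℝ} {F F' : Finset β} {A B B' : Set α}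
  {x y z : α} {r r' : ℝ}

/-- `y` can be reached from `x` along edges of `G` that belong to `F`. -/
def Reach (G : Graph α β) (F : Finset β) : α → α → Prop :=
  ReflTransGen fun u v => ∃ e ∈ F, G.IsLink e u v

lemma Reach.symm (h : Reach G F x y) : Reach G F y x := by
  induction h with
  | refl => exact .refl
  | tail _ hbc ih =>
    obtain ⟨e, he, hl⟩ := hbc
    exact .head ⟨e, he, hl.symm⟩ ih

lemma Reach.trans (h : Reach G F x y) (h' : Reach G F y z) : Reach G F x z :=
  ReflTransGen.trans h h'

lemma Reach.mono (hF : F ⊆ F') (h : Reach G F x y) : Reach G F' x y :=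
  ReflTransGen.mono (fun _ _ ⟨e, he, hl⟩ => ⟨e, hF he, hl⟩) _ _ h

lemma Reach.of_isLink {e : β} (he : e ∈ F) (h : G.IsLink e x y) : Reach G F x y :=
  .single ⟨e, he, h⟩

/-- Some set of edges of `G` of total length at most `r` connects the points of `B`. -/
def Joined (ℓ : β → ℝ) (G : Graph α β) (B : Set α) (r : ℝ) : Prop :=
  ∃ F : Finset β, (F : Set β) ⊆ E(G) ∧ (∀ a ∈ B, ∀ b ∈ B, Reach G F a b) ∧ ∑ e ∈ F, ℓ e ≤ r

lemma Joined.mono (h : Joined ℓ G B r) (hB : B' ⊆ B) (hr : r ≤ r') : Joined ℓ G B' r' := by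
  obtain ⟨F, hF, hj, hs⟩ := h
  exact ⟨F, hF, fun a ha b hb => hj a (hB ha) b (hB hb), hs.trans hr⟩

lemma Joined.nonneg (hℓ : IsLengthFunction G ℓ) (h : Joined ℓ G B r) : 0 ≤ r := by
  obtain ⟨F, hF, -, hs⟩ := h
  exact (Finset.sum_nonneg fun e he => (hℓ e (hF he)).le).trans hs

lemma joined_of_subsingleton (hB : B.Subsingleton) (hr : 0 ≤ r) : Joined ℓ G B r :=
  ⟨∅, by simp, fun a ha b hb => hB ha hb ▸ .refl, by simpa using hr⟩

lemma sum_union_le [DecidableEq β] (h : ∀ e ∈ F', 0 ≤ ℓ e) :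
    ∑ e ∈ F ∪ F', ℓ e ≤ ∑ e ∈ F, ℓ e + ∑ e ∈ F', ℓ e := by
  rw [← Finset.union_sdiff_self_eq_union, Finset.sum_union Finset.disjoint_sdiff]
  exact add_le_add le_rfl
    (Finset.sum_le_sum_of_subset_of_nonneg Finset.sdiff_subset fun e he _ => h e he)

lemma Joined.union (hℓ : IsLengthFunction G ℓ) (h : Joined ℓ G B r) (h' : Joined ℓ G B' r')
    (hx : x ∈ B) (hx' : x ∈ B') : Joined ℓ G (B ∪ B') (r + r') := by
  classical
  obtain ⟨F, hF, hj, hs⟩ := h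
  obtain ⟨F', hF', hj', hs'⟩ := h'
  have key : ∀ a ∈ B ∪ B', Reach G (F ∪ F') a x := by
    rintro a (ha | ha)
    · exact (hj a ha x hx).mono Finset.subset_union_left
    · exact (hj' a ha x hx').mono Finset.subset_union_right
  refine ⟨F ∪ F', ?_, fun a ha b hb => (key a ha).trans (key b hb).symm, ?_⟩
  · rw [Finset.coe_union]; exact Set.union_subset hF hF'
  · exact (sum_union_le fun e he => (hℓ e (hF' he)).le).trans (add_le_add hs hs')

lemma joined_pair_of_isLink {e : β} (h : G.IsLink e x y) : Joined ℓ G {x, y} (ℓ e) := by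
  have hr : Reach G {e} x y := .of_isLink (Finset.mem_singleton_self e) h
  refine ⟨{e}, by simpa using h.edge_mem, ?_, by simp⟩
  rintro a (rfl | rfl) b (rfl | rfl)
  exacts [.refl, hr, hr.symm, .refl]

/-! ### Rooted trees -/

/-- `RootedTree ℓ G x B r`: a tree of length `r` in `G` with root `x` and terminals `B`, assembled
by adding a root edge and by merging at the root. -/
inductive RootedTree (ℓ : β → ℝ) (G : Graph α β) : α → Set α → ℝ → Prop
  | nil (x : α) : RootedTree ℓ G x ∅ 0
  | self (x : α) : RootedTree ℓ G x {x} 0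
  | step {x y : α} {B : Set α} {r : ℝ} {e : β} :
      G.IsLink e x y → RootedTree ℓ G y B r → RootedTree ℓ G x B (r + ℓ e)
  | merge {x : α} {B B' : Set α} {r r' : ℝ} : Disjoint B B' →
      RootedTree ℓ G x B r → RootedTree ℓ G x B' r' → RootedTree ℓ G x (B ∪ B') (r + r')

lemma RootedTree.joined (hℓ : IsLengthFunction G ℓ) (h : RootedTree ℓ G x B r) :
    Joined ℓ G (insert x B) r := by
  induction h with
  | nil x => exact joined_of_subsingleton (by simp) le_rfl
  | self x => exact joined_of_subsingleton (by simp) le_rfl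
  | @step x y B r e hl _ ih =>
    exact (ih.union hℓ (joined_pair_of_isLink hl) (Set.mem_insert y B) (by simp)).mono
      (by grind) le_rfl
  | @merge x B B' r r' _ _ _ ih ih' =>
    exact (ih.union hℓ ih' (Set.mem_insert x B) (Set.mem_insert x B')).mono (by grind) le_rfl

/-- Only the part of a walk after its last use of `e` matters, and that part starts at an end of
`e`. -/
lemma Reach.erase [DecidableEq β] {e : β} (hl : G.IsLink e x y) (h : Reach G F x z) :
    Reach G (F.erase e) x z ∨ Reach G (F.erase e) y z := by
  induction h with
  | refl => exact .inl .refl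
  | @tail b c _ hbc ih =>
    obtain ⟨f, hf, hfl⟩ := hbc
    by_cases hfe : f = e
    · subst hfe
      rcases hfl.right_eq_or_eq hl with rfl | rfl
      · exact .inl .refl
      · exact .inr .refl
    · have : Reach G (F.erase e) b c := .of_isLink (Finset.mem_erase.2 ⟨hfe, hf⟩) hfl
      exact ih.imp (·.trans this) (·.trans this)

lemma Reach.component [DecidablePred fun e => ∃ u v, G.IsLink e u v ∧ Reach G F x u]
    (h : Reach G F x z) :
    Reach G (F.filter fun e => ∃ u v, G.IsLink e u v ∧ Reach G F x u) x z := by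
  induction h with
  | refl => exact .refl
  | @tail b c hb hbc ih =>
    obtain ⟨f, hf, hfl⟩ := hbc
    exact ih.trans (.of_isLink (Finset.mem_filter.2 ⟨hf, b, c, hfl, hb⟩) hfl)

/-- Induction on the number of edges. An edge `e` from `x` to `y` is removed. If `x` and `y` stay
connected, `e` was redundant. Otherwise the components of `x` and `y` share no edges and partition
the terminals, so their trees are merged at `x` through `e`. The constructor `nil` covers a
component without terminals. -/
lemma exists_rootedTree (hℓ : IsLengthFunction G ℓ) (hF : (F : Set β) ⊆ E(G))
    (hB : ∀ b ∈ B, Reach G F x b) : ∃ r ≤ ∑ e ∈ F, ℓ e, RootedTree ℓ G x B r := by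
  classical
  induction hn : F.card using Nat.strong_induction_on generalizing F x B with
  | _ n ih =>
  have hpos : ∀ F' ⊆ F, 0 ≤ ∑ e ∈ F', ℓ e := fun F' h =>
    Finset.sum_nonneg fun e he => (hℓ e (hF (h he))).le
  by_cases hBx : B ⊆ {x}
  · rcases Set.subset_singleton_iff_eq.1 hBx with rfl | rfl
    · exact ⟨0, hpos F le_rfl, .nil x⟩
    · exact ⟨0, hpos F le_rfl, .self x⟩
  obtain ⟨b, hb, hbx⟩ := Set.not_subset.1 hBx
  rcases (hB b hb).cases_head with rfl | ⟨y, ⟨e, he, hl⟩, -⟩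
  · exact absurd rfl hbx
  have hlt : (F.erase e).card < n := hn ▸ Finset.card_erase_lt_of_mem he
  have hsum : ∑ f ∈ F.erase e, ℓ f + ℓ e = ∑ f ∈ F, ℓ f := Finset.sum_erase_add F ℓ he
  have hle : 0 < ℓ e := hℓ e (hF he)
  have hFe : ((F.erase e : Finset β) : Set β) ⊆ E(G) := fun f hf =>
    hF (Finset.mem_of_mem_erase (Finset.mem_coe.1 hf))
  by_cases hxy : Reach G (F.erase e) x y
  · obtain ⟨r, hr, ht⟩ := ih _ hlt hFe
      (fun b hb => ((hB b hb).erase hl).elim id (hxy.trans ·)) rfl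
    exact ⟨r, by linarith, ht⟩
  have hdis : Disjoint
      ((F.erase e).filter fun f => ∃ u v, G.IsLink f u v ∧ Reach G (F.erase e) x u)
      ((F.erase e).filter fun f => ∃ u v, G.IsLink f u v ∧ Reach G (F.erase e) y u) := by
    rw [Finset.disjoint_left]
    intro f hf hf'
    obtain ⟨hfF, u, v, hfl, hu⟩ := Finset.mem_filter.1 hf
    obtain ⟨-, u', v', hfl', hu'⟩ := Finset.mem_filter.1 hf'
    rcases hfl'.left_eq_or_eq hfl with rfl | rfl
    · exact hxy (hu.trans hu'.symm)
    · exact hxy ((hu.trans (.of_isLink hfF hfl)).trans hu'.symm)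
  have hsub := fun a => Finset.filter_subset
    (fun f => ∃ u v, G.IsLink f u v ∧ Reach G (F.erase e) a u) (F.erase e)
  obtain ⟨r, hr, ht⟩ := ih _ ((Finset.card_le_card (hsub x)).trans_lt hlt)
    (x := x) (B := {b ∈ B | Reach G (F.erase e) x b})
    (fun f hf => hFe (hsub x hf)) (fun b hb => hb.2.component) rfl
  obtain ⟨r', hr', ht'⟩ := ih _ ((Finset.card_le_card (hsub y)).trans_lt hlt)
    (x := y) (B := {b ∈ B | Reach G (F.erase e) y b})
    (fun f hf => hFe (hsub y hf)) (fun b hb => hb.2.component) rfl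
  refine ⟨r + (r' + ℓ e), ?_, ?_⟩
  · have h1 := Finset.sum_union hdis (f := ℓ)
    have h2 := Finset.sum_le_sum_of_subset_of_nonneg (Finset.union_subset (hsub x) (hsub y))
      (f := ℓ) fun f hf _ => (hℓ f (hFe hf)).le
    linarith
  · have hBu : B = {b ∈ B | Reach G (F.erase e) x b} ∪ {b ∈ B | Reach G (F.erase e) y b} := by
      ext b
      exact ⟨fun hb => ((hB b hb).erase hl).imp (⟨hb, ·⟩) (⟨hb, ·⟩), fun h => h.elim (·.1) (·.1)⟩
    rw [hBu]
    refine .merge ?_ ht (.step hl ht')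
    exact Set.disjoint_left.2 fun b hb hb' => hxy (hb.2.trans hb'.2.symm)

lemma Joined.exists_rootedTree (hℓ : IsLengthFunction G ℓ) (h : Joined ℓ G (insert x B) r) :
    ∃ r' ≤ r, RootedTree ℓ G x B r' := by
  obtain ⟨F, hF, hj, hs⟩ := h
  obtain ⟨r', hr', ht⟩ := SteinerGeodesic.exists_rootedTree hℓ hF
    fun b hb => hj x (Set.mem_insert x B) b (Set.mem_insert_of_mem x hb)
  exact ⟨r', hr'.trans hs, ht⟩

/-- Going up from the root, `y` is the first place where two nonempty terminal sets are merged; the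
root edges passed on the way form the connection from `x` to `y`. -/
lemma RootedTree.exists_split (hℓ : IsLengthFunction G ℓ) (h : RootedTree ℓ G x B r)
    (hB : B.Nontrivial) : ∃ (y : α) (B₁ B₂ : Set α) (r₀ r₁ r₂ : ℝ), B₁.Nonempty ∧ B₂.Nonempty ∧
      Disjoint B₁ B₂ ∧ B₁ ∪ B₂ = B ∧ r₀ + r₁ + r₂ ≤ r ∧ Joined ℓ G {x, y} r₀ ∧
      Joined ℓ G (insert y B₁) r₁ ∧ Joined ℓ G (insert y B₂) r₂ := by
  induction h with
  | nil x => exact absurd hB (by simp)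
  | self x => exact absurd hB (by simp)
  | @step x y B r e hl _ ih =>
    obtain ⟨z, B₁, B₂, r₀, r₁, r₂, h₁, h₂, hd, hu, hr, h0, h1, h2⟩ := ih hB
    refine ⟨z, B₁, B₂, r₀ + ℓ e, r₁, r₂, h₁, h₂, hd, hu, by linarith, ?_, h1, h2⟩
    exact (h0.union hℓ (joined_pair_of_isLink hl) (x := y) (by simp) (by simp)).mono
      (by grind) le_rfl
  | @merge x B B' r r' hd ht ht' ih ih' =>
    have h0 := (ht.joined hℓ).nonneg hℓ
    have h0' := (ht'.joined hℓ).nonneg hℓ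
    rcases B.eq_empty_or_nonempty with rfl | hne
    · rw [Set.empty_union] at hB ⊢
      obtain ⟨z, B₁, B₂, r₀, r₁, r₂, h₁, h₂, hd, hu, hr, h⟩ := ih' hB
      exact ⟨z, B₁, B₂, r₀, r₁, r₂, h₁, h₂, hd, hu, by linarith, h⟩
    rcases B'.eq_empty_or_nonempty with rfl | hne'
    · rw [Set.union_empty] at hB ⊢
      obtain ⟨z, B₁, B₂, r₀, r₁, r₂, h₁, h₂, hd, hu, hr, h⟩ := ih hB
      exact ⟨z, B₁, B₂, r₀, r₁, r₂, h₁, h₂, hd, hu, by linarith, h⟩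
    exact ⟨x, B, B', 0, r, r', hne, hne', hd, rfl, by linarith,
      joined_of_subsingleton (by simp) le_rfl, ht.joined hℓ, ht'.joined hℓ⟩

/-- The Dreyfus–Wagner decomposition. -/
lemma Joined.exists_split (hℓ : IsLengthFunction G ℓ) (h : Joined ℓ G (insert x B) r)
    (hB : B.Nontrivial) : ∃ (y : α) (B₁ B₂ : Set α) (r₀ r₁ r₂ : ℝ), B₁.Nonempty ∧ B₂.Nonempty ∧
      Disjoint B₁ B₂ ∧ B₁ ∪ B₂ = B ∧ r₀ + r₁ + r₂ ≤ r ∧ Joined ℓ G {x, y} r₀ ∧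
      Joined ℓ G (insert y B₁) r₁ ∧ Joined ℓ G (insert y B₂) r₂ := by
  obtain ⟨r', hr', ht⟩ := h.exists_rootedTree hℓ
  obtain ⟨y, B₁, B₂, r₀, r₁, r₂, h₁, h₂, hd, hu, hr, h⟩ := ht.exists_split hℓ hB
  exact ⟨y, B₁, B₂, r₀, r₁, r₂, h₁, h₂, hd, hu, hr.trans hr', h⟩

/-! ### Steiner distance -/

lemma length_nonneg (hℓ : IsLengthFunction G ℓ) (hH : H ≤ G) : 0 ≤ length ℓ H :=
  finsum_nonneg fun e => finsum_nonneg fun he => (hℓ e (hH.edgeSet_mono he)).le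

lemma Connected.joined (hE : E(G).Finite) (hH : H ≤ G) (h : Connected H) (hB : B ⊆ V(H)) :
    Joined ℓ G B (length ℓ H) := by
  have hEH : E(H).Finite := hE.subset hH.edgeSet_mono
  refine ⟨hEH.toFinset, by simpa using hH.edgeSet_mono, fun a ha b hb => ?_, ?_⟩
  · refine ReflTransGen.mono ?_ _ _ (h.2 a (hB ha) b (hB hb))
    rintro u v ⟨e, he⟩
    exact ⟨e, by simpa using he.edge_mem, he.mono hH⟩
  · rw [length, finsum_mem_eq_finite_toFinset_sum _ hEH]

lemma Joined.exists_connected (hℓ : IsLengthFunction G ℓ) (h : Joined ℓ G B r)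
    (hne : B.Nonempty) (hB : B ⊆ V(G)) :
    ∃ S ≤ G, Connected S ∧ B ⊆ V(S) ∧ length ℓ S ≤ r := by
  classical
  obtain ⟨F, hF, hj, hs⟩ := h
  obtain ⟨x, hx⟩ := hne
  have hV : ∀ y, Reach G F x y → y ∈ V(G) := by
    intro y hy
    rcases hy.cases_tail with rfl | ⟨z, -, e, -, hl⟩
    · exact hB hx
    · exact hl.right_mem
  let S : Graph α β :=
    { vertexSet := {y | Reach G F x y}
      IsLink := fun e u v => e ∈ F ∧ G.IsLink e u v ∧ Reach G F x u
      isLink_symm := fun e _ => ⟨fun u v h => ⟨h.1, h.2.1.symm,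
        h.2.2.trans (.of_isLink h.1 h.2.1)⟩⟩
      eq_or_eq_of_isLink_of_isLink := fun e x y v w h h' => h.2.1.left_eq_or_eq h'.2.1
      left_mem_of_isLink := fun e u v h => h.2.2 }
  have hSF : E(S) ⊆ F := by
    rintro e he
    obtain ⟨u, v, h⟩ := S.exists_isLink_of_mem_edgeSet he
    exact h.1
  have hx0 : ∀ y, Reach G F x y → ReflTransGen S.Adj x y := by
    intro y hy
    induction hy with
    | refl => exact .refl
    | tail hb hbc ih =>
      obtain ⟨e, he, hl⟩ := hbc
      exact ih.tail ⟨e, he, hl, hb⟩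
  have hsym : ∀ u v, ReflTransGen S.Adj u v → ReflTransGen S.Adj v u := by
    intro u v h
    induction h with
    | refl => exact .refl
    | tail _ hbc ih => exact .head hbc.symm ih
  refine ⟨S, ⟨hV, fun e u v h => h.2.1⟩, ⟨⟨x, .refl⟩, fun u hu v hv => ?_⟩,
    fun b hb => hj x hx b hb, ?_⟩
  · exact (hsym _ _ (hx0 u hu)).trans (hx0 v hv)
  · have hfin : E(S).Finite := F.finite_toSet.subset hSF
    refine le_trans ?_ hs
    rw [length, finsum_mem_eq_finite_toFinset_sum _ hfin]
    exact Finset.sum_le_sum_of_subset_of_nonneg (by simpa using hSF)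
      fun e he _ => (hℓ e (hF he)).le

lemma steinerDist_le_of_joined (hℓ : IsLengthFunction G ℓ) (h : Joined ℓ G B r)
    (hne : B.Nonempty) (hB : B ⊆ V(G)) : steinerDist ℓ G B ≤ r := by
  obtain ⟨S, hS, hc, hBS, hr⟩ := h.exists_connected hℓ hne hB
  have h1 : steinerDist ℓ G B ≤ (length ℓ S : ℝ) := sInf_le ⟨S, hS, hc, hBS, rfl⟩
  exact h1.trans (EReal.coe_le_coe_iff.2 hr)

/-- Finitely many edge sets give finitely many lengths, so the infimum is attained. -/
lemma joined_of_steinerDist_le (hE : E(G).Finite) (h : steinerDist ℓ G B ≤ r) :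
    Joined ℓ G B r := by
  set R := {r : EReal | ∃ S : Graph α β, S ≤ G ∧ Connected S ∧ B ⊆ V(S) ∧
    r = ((length ℓ S : ℝ) : EReal)} with hR
  have hfin : R.Finite := by
    refine (hE.finite_subsets.image fun E' => (((∑ᶠ e ∈ E', ℓ e : ℝ)) : EReal)).subset ?_
    rintro _ ⟨S, hS, -, -, rfl⟩
    exact ⟨E(S), hS.edgeSet_mono, rfl⟩
  have hne : R.Nonempty := by
    rw [Set.nonempty_iff_ne_empty]
    intro h0
    have : steinerDist ℓ G B = ⊤ := by rw [steinerDist, ← hR, h0, sInf_empty]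
    rw [this] at h
    exact absurd h (by simp)
  obtain ⟨S, hS, hc, hBS, hr⟩ := hne.csInf_mem hfin
  have : steinerDist ℓ G B = ((length ℓ S : ℝ) : EReal) := hr
  rw [this, EReal.coe_le_coe_iff] at h
  exact (hc.joined hE hS hBS).mono le_rfl h

lemma steinerDist_anti (hH : H ≤ G) : steinerDist ℓ G B ≤ steinerDist ℓ H B :=
  sInf_le_sInf fun _ ⟨S, hS, h⟩ => ⟨S, hS.trans hH, h⟩

lemma IsLengthFunction.of_le (hH : H ≤ G) (hℓ : IsLengthFunction G ℓ) : IsLengthFunction H ℓ :=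
  fun e he => hℓ e (hH.edgeSet_mono he)

lemma steinerDist_eq_of_joined (hE : E(G).Finite) (hℓ : IsLengthFunction G ℓ) (hC : C ≤ G)
    (hne : V(C).Nonempty) (hB : B ⊆ V(C)) (h : ∀ r, Joined ℓ G B r → Joined ℓ C B r) :
    steinerDist ℓ C B = steinerDist ℓ G B := by
  refine le_antisymm (le_sInf ?_) (steinerDist_anti hC)
  rintro _ ⟨S, hS, hc, hBS, rfl⟩
  -- Connected subgraphs are nonempty, so for `B = ∅` a single vertex of `C` serves as the
  -- competitor of length 0.
  rcases B.eq_empty_or_nonempty with rfl | hB'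
  · obtain ⟨x, hx⟩ := hne
    have h1 : steinerDist ℓ C {x} ≤ (length ℓ S : ℝ) :=
      steinerDist_le_of_joined (hℓ.of_le hC)
        (joined_of_subsingleton Set.subsingleton_singleton (length_nonneg hℓ hS))
        (Set.singleton_nonempty x) (by simpa using hx)
    have h2 : steinerDist ℓ C ∅ ≤ steinerDist ℓ C {x} :=
      sInf_le_sInf fun _ ⟨S, hS, h, _, h'⟩ => ⟨S, hS, h, Set.empty_subset _, h'⟩
    exact h2.trans h1
  · exact steinerDist_le_of_joined (hℓ.of_le hC) (h _ (hc.joined hE hS hBS)) hB' hB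

lemma Joined.of_steinerDist_eq (hE : E(G).Finite) (hℓ : IsLengthFunction G ℓ) (hC : C ≤ G)
    (hne : B.Nonempty) (hB : B ⊆ V(C)) (h : steinerDist ℓ C B = steinerDist ℓ G B)
    (hj : Joined ℓ G B r) : Joined ℓ C B r :=
  joined_of_steinerDist_le (hE.subset hC.edgeSet_mono)
    (h ▸ steinerDist_le_of_joined hℓ hj hne (hB.trans hC.vertexSet_mono))

end Joined

/-! ### Arcs, cuts and crossings on a parametrised cycle -/

section Frame

variable {α β : Type*} {C : Graph α β} {ℓ : β → ℝ} {F : Finset β} {A B X Y : Set α}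
  {n : ℕ} {w : ℕ → α} {d : ℕ → β} {r t : ℝ}

/-- A linear parametrisation of a cycle: the vertices are `w 0, …, w (n - 1)`, `w n = w 0`, and
the edge `d j` joins `w j` to `w (j + 1)`. -/
structure Frame (C : Graph α β) (n : ℕ) (w : ℕ → α) (d : ℕ → β) : Prop where
  pos : 0 < n
  wrap : w n = w 0
  inj_vertex : ∀ i < n, ∀ j < n, w i = w j → i = j
  inj_edge : ∀ i < n, ∀ j < n, d i = d j → i = j
  exists_vertex : ∀ x ∈ V(C), ∃ i < n, w i = x
  exists_edge : ∀ e ∈ E(C), ∃ j < n, d j = e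
  link : ∀ j < n, C.IsLink (d j) (w j) (w (j + 1))

lemma frame_of_zmod (hn : 0 < n) {v : ZMod n → α} {e : ZMod n → β} (hv : Function.Injective v)
    (he : Function.Injective e) (hV : V(C) = Set.range v) (hE : E(C) = Set.range e)
    (hl : ∀ i, C.IsLink (e i) (v i) (v (i + 1))) :
    Frame C n (fun i => v (i : ZMod n)) (fun i => e (i : ZMod n)) := by
  have : NeZero n := ⟨hn.ne'⟩
  have hcast : ∀ i < n, ∀ j < n, (i : ZMod n) = j → i = j := fun i hi j hj h => by
    rw [ZMod.natCast_eq_natCast_iff', Nat.mod_eq_of_lt hi, Nat.mod_eq_of_lt hj] at h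
    exact h
  refine ⟨hn, by simp, fun i hi j hj h => hcast i hi j hj (hv h),
    fun i hi j hj h => hcast i hi j hj (he h), ?_, ?_, fun j _ => by simpa using hl j⟩
  · rw [hV]
    rintro _ ⟨i, rfl⟩
    exact ⟨i.val, i.val_lt, by simp⟩
  · rw [hE]
    rintro _ ⟨i, rfl⟩
    exact ⟨i.val, i.val_lt, by simp⟩

/-- A cycle has, for each of its vertices, two parametrisations that start there and run in
opposite directions. -/
lemma IsCycle.exists_frame (hC : IsCycle C) {x : α} (hx : x ∈ V(C)) :
    ∃ (n : ℕ) (w : ℕ → α) (d : ℕ → β) (w' : ℕ → α) (d' : ℕ → β),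
      Frame C n w d ∧ Frame C n w' d' ∧ w 0 = x ∧ w' 0 = x ∧ ∀ i ≤ n, w' i = w (n - i) := by
  obtain ⟨n, hn, v, e, hv, he, hV, hE, hl⟩ := hC
  obtain ⟨k, rfl⟩ : x ∈ Set.range v := hV ▸ hx
  have hadd : Function.Surjective fun i : ZMod n => k + i := fun y => ⟨y - k, by simp⟩
  have hsub : Function.Surjective fun i : ZMod n => k - i := fun y => ⟨k - y, by simp⟩
  have hsub' : Function.Surjective fun i : ZMod n => k - i - 1 := fun y =>
    ⟨k - y - 1, by ring⟩
  refine ⟨n, _, _, _, _,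
    frame_of_zmod (v := fun i => v (k + i)) (e := fun i => e (k + i)) (by lia)
      (hv.comp (add_right_injective k)) (he.comp (add_right_injective k))
      (hV.trans (hadd.range_comp v).symm) (hE.trans (hadd.range_comp e).symm) ?_,
    frame_of_zmod (v := fun i => v (k - i)) (e := fun i => e (k - i - 1)) (by lia)
      (hv.comp sub_right_injective)
      (he.comp fun i j h => sub_right_injective (sub_left_injective h))
      (hV.trans (hsub.range_comp v).symm) (hE.trans (hsub'.range_comp e).symm) ?_,
    by simp, by simp, ?_⟩
  · intro i
    simpa [add_assoc] using hl (k + i)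
  · intro i
    have := (hl (k - i - 1)).symm
    rw [sub_add_cancel] at this
    rwa [← sub_sub]
  · intro i hi
    simp [Nat.cast_sub hi, sub_eq_add_neg]

/-- The length of the first `k` edges of a parametrised cycle. -/
noncomputable def prefixLength (ℓ : β → ℝ) (d : ℕ → β) (k : ℕ) : ℝ :=
  ∑ j ∈ Finset.range k, ℓ (d j)

lemma Frame.length_pos (h : Frame C n w d) (hℓ : IsLengthFunction C ℓ) {j : ℕ} (hj : j < n) :
    0 < ℓ (d j) :=
  hℓ _ (h.link j hj).edge_mem

lemma Frame.prefixLength_mono (h : Frame C n w d) (hℓ : IsLengthFunction C ℓ) {x y : ℕ}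
    (hxy : x ≤ y) (hy : y ≤ n) : prefixLength ℓ d x ≤ prefixLength ℓ d y :=
  Finset.sum_le_sum_of_subset_of_nonneg (by simpa using hxy) fun j hj _ =>
    (h.length_pos hℓ ((Finset.mem_range.1 hj).trans_le hy)).le

lemma sum_Ico_eq_prefixLength {x y : ℕ} (hxy : x ≤ y) :
    ∑ j ∈ Finset.Ico x y, ℓ (d j) = prefixLength ℓ d y - prefixLength ℓ d x :=
  Finset.sum_Ico_eq_sub _ hxy

lemma sum_sdiff_Ico_eq_prefixLength {x y : ℕ} (hxy : x ≤ y) (hy : y ≤ n) :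
    ∑ j ∈ Finset.range n \ Finset.Ico x y, ℓ (d j) =
      prefixLength ℓ d n - (prefixLength ℓ d y - prefixLength ℓ d x) := by
  have hs : Finset.Ico x y ⊆ Finset.range n := fun j hj =>
    Finset.mem_range.2 ((Finset.mem_Ico.1 hj).2.trans_le hy)
  rw [← sum_Ico_eq_prefixLength hxy, prefixLength, ← Finset.sum_sdiff hs]
  ring

lemma Frame.sum_image (h : Frame C n w d) [DecidableEq β] {J : Finset ℕ} (hJ : ∀ j ∈ J, j < n) :
    ∑ e ∈ J.image d, ℓ e = ∑ j ∈ J, ℓ (d j) :=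
  Finset.sum_image fun i hi j hj hij => h.inj_edge i (hJ i hi) j (hJ j hj) hij

lemma Frame.sum_le (h : Frame C n w d) (hℓ : IsLengthFunction C ℓ) (hF : (F : Set β) ⊆ E(C))
    {J : Finset ℕ} (hJ : ∀ j ∈ J, j < n) (hJF : ∀ j ∈ J, d j ∈ F) :
    ∑ j ∈ J, ℓ (d j) ≤ ∑ e ∈ F, ℓ e := by
  classical
  rw [← h.sum_image hJ]
  refine Finset.sum_le_sum_of_subset_of_nonneg ?_ fun e he _ => (hℓ e (hF he)).le
  intro e he
  obtain ⟨j, hj, rfl⟩ := Finset.mem_image.1 he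
  exact hJF j hj

lemma Frame.reach (h : Frame C n w d) {a b : ℕ} (hab : a ≤ b) (hb : b ≤ n)
    (hF : ∀ j, a ≤ j → j < b → d j ∈ F) : Reach C F (w a) (w b) := by
  induction b, hab using Nat.le_induction with
  | base => exact .refl
  | succ b hab ih =>
    exact (ih (by lia) fun j hj hjb => hF j hj (by lia)).trans
      (.of_isLink (hF b hab (by lia)) (h.link b (by lia)))

/-- Two missing edges separate the cycle. -/
lemma Frame.not_reach (h : Frame C n w d) (hF : (F : Set β) ⊆ E(C)) {j j' x y : ℕ}
    (hj : d j ∉ F) (hj' : d j' ∉ F) (hj'n : j' < n) (hx : j < x) (hx' : x ≤ j') (hy : y ≤ n)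
    (hyj : y ≤ j ∨ j' < y) : ¬ Reach C F (w x) (w y) := by
  intro hr
  have key : ∀ z, Reach C F (w x) z → ∃ i, j < i ∧ i ≤ j' ∧ w i = z := by
    intro z hz
    induction hz with
    | refl => exact ⟨x, hx, hx', rfl⟩
    | @tail u v _ huv ih =>
      obtain ⟨i, hi, hi', rfl⟩ := ih
      obtain ⟨e, he, hl⟩ := huv
      obtain ⟨m, hm, rfl⟩ := h.exists_edge e (hF he)
      have hmj : m ≠ j := fun hh => hj (hh ▸ he)
      have hmj' : m ≠ j' := fun hh => hj' (hh ▸ he)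
      have hlm := h.link m hm
      rcases hl.eq_and_eq_or_eq_and_eq hlm with ⟨h1, rfl⟩ | ⟨h1, rfl⟩
      · obtain rfl := h.inj_vertex i (by lia) m hm h1
        exact ⟨i + 1, by lia, by lia, rfl⟩
      · rcases (show m + 1 < n ∨ m + 1 = n by lia) with h2 | h2
        · obtain rfl := h.inj_vertex i (by lia) _ h2 h1
          exact ⟨m, by lia, by lia, rfl⟩
        · rw [h2, h.wrap] at h1
          have := h.inj_vertex i (by lia) 0 h.pos h1
          lia
  obtain ⟨i, hi, hi', hiy⟩ := key _ hr
  rcases hy.lt_or_eq with hy' | rfl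
  · have := h.inj_vertex i (by lia) y hy' hiy
    lia
  · rw [h.wrap] at hiy
    have := h.inj_vertex i (by lia) 0 h.pos hiy
    lia

/-- An edge set joining two points of the cycle contains one of the two arcs between them. -/
lemma Frame.arc_subset (h : Frame C n w d) (hF : (F : Set β) ⊆ E(C)) {x y : ℕ} (hxy : x ≤ y)
    (hy : y ≤ n) (hr : Reach C F (w x) (w y)) :
    (∀ j, x ≤ j → j < y → d j ∈ F) ∨ (∀ j < n, j < x ∨ y ≤ j → d j ∈ F) := by
  by_contra! hcon
  obtain ⟨⟨j, hxj, hjy, hj⟩, j', hj'n, hj'xy, hj'⟩ := hcon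
  rcases hj'xy with h1 | h1
  · exact h.not_reach hF hj' hj (by lia) h1 hxj hy (.inr hjy) hr
  · exact h.not_reach hF hj hj' hj'n hjy h1 (by lia) (.inl hxj) hr.symm

/-- The edge `d j` is one that the joining set omits. Any two points of `B` are then joined by the
arc avoiding it, so that arc costs at most `r`. -/
lemma Frame.exists_cut (h : Frame C n w d) (hℓ : IsLengthFunction C ℓ) (hB : Joined ℓ C B r) :
    ∃ j < n, ∀ x y, x ≤ y → y ≤ n → w x ∈ B → w y ∈ B →
      (x ≤ j → j < y →
        prefixLength ℓ d n - (prefixLength ℓ d y - prefixLength ℓ d x) ≤ r) ∧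
      (y ≤ j ∨ j < x → prefixLength ℓ d y - prefixLength ℓ d x ≤ r) := by
  obtain ⟨F, hF, hj, hs⟩ := hB
  have hin : ∀ x y, x ≤ y → y ≤ n → (∀ j, x ≤ j → j < y → d j ∈ F) →
      prefixLength ℓ d y - prefixLength ℓ d x ≤ r := fun x y hxy hy hJ => by
    rw [← sum_Ico_eq_prefixLength hxy]
    exact (h.sum_le hℓ hF (fun j hj => (Finset.mem_Ico.1 hj).2.trans_le hy)
      fun j hj => hJ j (Finset.mem_Ico.1 hj).1 (Finset.mem_Ico.1 hj).2).trans hs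
  have hout : ∀ x y, x ≤ y → y ≤ n → (∀ j < n, j < x ∨ y ≤ j → d j ∈ F) →
      prefixLength ℓ d n - (prefixLength ℓ d y - prefixLength ℓ d x) ≤ r :=
    fun x y hxy hy hJ => by
      rw [← sum_sdiff_Ico_eq_prefixLength hxy hy]
      refine (h.sum_le hℓ hF (fun j hj => by simp at hj; lia) fun j hj => ?_).trans hs
      simp only [Finset.mem_sdiff, Finset.mem_range, Finset.mem_Ico, not_and, not_lt] at hj
      exact hJ j hj.1 (by lia)
  -- If no edge is omitted, both arcs between any two points are paid for and every `j` serves.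
  by_cases hall : ∀ j < n, d j ∈ F
  · refine ⟨0, h.pos, fun x y hxy hy _ _ => ⟨fun _ _ => ?_, fun _ => ?_⟩⟩
    · exact hout x y hxy hy fun j hj _ => hall j hj
    · exact hin x y hxy hy fun j _ hj => hall j (hj.trans_le hy)
  push Not at hall
  obtain ⟨j, hjn, hjF⟩ := hall
  refine ⟨j, hjn, fun x y hxy hy hx hy' => ⟨fun hxj hjy => ?_, fun hjxy => ?_⟩⟩
  · exact hout x y hxy hy ((h.arc_subset hF hxy hy (hj _ hx _ hy')).resolve_left
      fun hh => hjF (hh j hxj hjy))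
  · exact hin x y hxy hy ((h.arc_subset hF hxy hy (hj _ hx _ hy')).resolve_right
      fun hh => hjF (hh j hjn hjxy.symm))

lemma Frame.joined_arc (h : Frame C n w d) {x y : ℕ} (hxy : x ≤ y) (hy : y ≤ n)
    (hB : ∀ b ∈ B, ∃ i, x ≤ i ∧ i ≤ y ∧ w i = b) :
    Joined ℓ C B (prefixLength ℓ d y - prefixLength ℓ d x) := by
  classical
  have hlt : ∀ j ∈ Finset.Ico x y, j < n := fun j hj => (Finset.mem_Ico.1 hj).2.trans_le hy
  have key : ∀ b ∈ B, Reach C ((Finset.Ico x y).image d) (w x) b := by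
    intro b hb
    obtain ⟨i, hi, hi', rfl⟩ := hB b hb
    exact h.reach hi (hi'.trans hy) fun j hj hj' =>
      Finset.mem_image_of_mem d (Finset.mem_Ico.2 ⟨hj, by lia⟩)
  refine ⟨(Finset.Ico x y).image d, ?_, fun a ha b hb => (key a ha).symm.trans (key b hb), ?_⟩
  · intro e he
    obtain ⟨j, hj, rfl⟩ := Finset.mem_image.1 (Finset.mem_coe.1 he)
    exact (h.link j (hlt j hj)).edge_mem
  · rw [h.sum_image hlt, sum_Ico_eq_prefixLength hxy]

lemma Frame.joined_compl_arc (h : Frame C n w d) {x y : ℕ} (hxy : x ≤ y) (hy : y ≤ n)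
    (hB : ∀ b ∈ B, ∃ i ≤ n, (i ≤ x ∨ y ≤ i) ∧ w i = b) :
    Joined ℓ C B (prefixLength ℓ d n - (prefixLength ℓ d y - prefixLength ℓ d x)) := by
  classical
  set J := Finset.range n \ Finset.Ico x y with hJ
  have hlt : ∀ j ∈ J, j < n := fun j hj => by simp [hJ] at hj; lia
  have hmem : ∀ j < n, j < x ∨ y ≤ j → d j ∈ J.image d := fun j hj hj' =>
    Finset.mem_image_of_mem d (by simp [hJ]; lia)
  have key : ∀ b ∈ B, Reach C (J.image d) (w 0) b := by
    intro b hb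
    obtain ⟨i, hi, hi' | hi', rfl⟩ := hB b hb
    · exact h.reach (Nat.zero_le i) hi fun j _ hj => hmem j (by lia) (by lia)
    · rw [← h.wrap]
      exact (h.reach hi le_rfl fun j hj hjn => hmem j hjn (by lia)).symm
  refine ⟨J.image d, ?_, fun a ha b hb => (key a ha).symm.trans (key b hb), ?_⟩
  · intro e he
    obtain ⟨j, hj, rfl⟩ := Finset.mem_image.1 (Finset.mem_coe.1 he)
    exact (h.link j (hlt j hj)).edge_mem
  · rw [h.sum_image hlt, sum_sdiff_Ico_eq_prefixLength hxy hy]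

/-- If two parts of `A` can be joined separately at no greater total cost than `A`, then they do
not cross on the cycle. -/
lemma Frame.not_crossing (h : Frame C n w d) (hℓ : IsLengthFunction C ℓ) {rX rY : ℝ}
    (hX : Joined ℓ C X rX) (hY : Joined ℓ C Y rY) (hr : rX + rY ≤ r)
    (hA : ¬ Joined ℓ C (X ∪ Y) r) {x y x' y' : ℕ} (hxy : x ≤ y) (hyx' : y ≤ x') (hxy' : x' ≤ y')
    (hy' : y' ≤ n) (hx : w x ∈ X) (hy : w y ∈ Y) (hx' : w x' ∈ X) : w y' ∉ Y := by
  intro hyY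
  obtain ⟨F, hF, hj, hs⟩ := hX
  have : ∃ z ∈ Y, Reach C F (w x) z := by
    rcases h.arc_subset hF (hxy.trans hyx') (by lia) (hj _ hx _ hx') with h1 | h1
    · exact ⟨w y, hy, h.reach hxy (by lia) fun j hj hj' => h1 j hj (by lia)⟩
    · exact ⟨w y', hyY, (hj _ hx _ hx').trans
        (h.reach hxy' hy' fun j hj hj' => h1 j (by lia) (.inr hj))⟩
  obtain ⟨z, hz, hxz⟩ := this
  have hXz : Joined ℓ C (insert z X) rX := by
    have key : ∀ a ∈ insert z X, Reach C F (w x) a := by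
      rintro a (rfl | ha)
      exacts [hxz, hj _ hx _ ha]
    exact ⟨F, hF, fun a ha b hb => (key a ha).symm.trans (key b hb), hs⟩
  exact hA ((hXz.union hℓ hY (Set.mem_insert z X) hz).mono (by grind) hr)

/-- A set joined at cost less than `A` misses, at the place where the joining arc is cut, one of
the two neighbouring points of `A`. -/
lemma Frame.exists_cut_of_not_joined (h : Frame C n w d) (hℓ : IsLengthFunction C ℓ)
    (hAC : A ⊆ V(C)) (h0 : w 0 ∈ A) (hA : ¬ Joined ℓ C A t) (hB : Joined ℓ C B r) (hrt : r ≤ t) :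
    ∃ j x y, x ≤ j ∧ j < y ∧ y ≤ n ∧ w x ∈ A ∧ w y ∈ A ∧ (∀ i, x < i → i < y → w i ∉ A) ∧
      ¬ (w x ∈ B ∧ w y ∈ B) ∧ ∀ x y, x ≤ y → y ≤ n → w x ∈ B → w y ∈ B →
      (x ≤ j → j < y →
        prefixLength ℓ d n - (prefixLength ℓ d y - prefixLength ℓ d x) ≤ r) ∧
      (y ≤ j ∨ j < x → prefixLength ℓ d y - prefixLength ℓ d x ≤ r) := by
  classical
  obtain ⟨j, hj, hcut⟩ := h.exists_cut hℓ hB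
  have hex : ∃ y, j < y ∧ w y ∈ A := ⟨n, hj, by rwa [h.wrap]⟩
  obtain ⟨hy1, hy2⟩ := Nat.find_spec hex
  have hyn : Nat.find hex ≤ n := Nat.find_min' hex ⟨hj, by rwa [h.wrap]⟩
  set y := Nat.find hex with hy
  have hmin : ∀ i, j < i → i < y → w i ∉ A := fun i hi hiy hiA =>
    Nat.find_min hex hiy ⟨hi, hiA⟩
  have hx1 := Nat.findGreatest_spec (P := fun i => w i ∈ A) (Nat.zero_le j) h0
  have hx2 := Nat.findGreatest_le (P := fun i => w i ∈ A) j
  have hx3 : ∀ i, Nat.findGreatest (fun i => w i ∈ A) j < i → i ≤ j → w i ∉ A :=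
    fun i hi hij => Nat.findGreatest_is_greatest hi hij
  set x := Nat.findGreatest (fun i => w i ∈ A) j
  have hno : ∀ i, x < i → i < y → w i ∉ A := fun i hi hiy =>
    (le_or_gt i j).elim (hx3 i hi) fun hij => hmin i hij hiy
  refine ⟨j, x, y, hx2, hy1, hyn, hx1, hy2, hno, fun hxy => ?_, hcut⟩
  -- No point of `A` lies strictly between `x` and `y`. If both ends were in `B`, the arc the other
  -- way round would be paid for and would contain all of `A`.
  refine hA (Joined.mono (h.joined_compl_arc (x := x) (y := y) (by lia) hyn ?_) le_rfl
    (((hcut x y (by lia) hyn hxy.1 hxy.2).1 hx2 hy1).trans hrt))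
  intro b hb
  obtain ⟨i, hi, rfl⟩ := h.exists_vertex b (hAC hb)
  refine ⟨i, hi.le, ?_, rfl⟩
  by_contra! hcon
  exact hno i hcon.1 hcon.2 hb

/-- The complement of a gap of `A` is an arc joining `A`, so it costs more than `t`. -/
lemma Frame.gap_lt (h : Frame C n w d) (hAC : A ⊆ V(C)) (hA : ¬ Joined ℓ C A t) {x y : ℕ}
    (hxy : x ≤ y) (hy : y ≤ n) (hno : ∀ i, x < i → i < y → w i ∉ A) :
    t < prefixLength ℓ d n - (prefixLength ℓ d y - prefixLength ℓ d x) := by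
  by_contra! hcon
  refine hA ((h.joined_compl_arc hxy hy fun b hb => ?_).mono le_rfl hcon)
  obtain ⟨i, hi, rfl⟩ := h.exists_vertex b (hAC hb)
  refine ⟨i, hi.le, ?_, rfl⟩
  by_contra! hcon
  exact hno i hcon.1 hcon.2 hb

end Frame

/-! ### Trees with five branches and the costs they induce on the cycle -/

section FiveBranch

variable {α β : Type*} {G C : Graph α β} {ℓ : β → ℝ} {A A₁ A₂ B₀ B₁ B₂ : Set α}
  {u v z : α} {a₁ a₂ b₀ b₁ b₂ ε δ t : ℝ} {n : ℕ} {w : ℕ → α} {d : ℕ → β}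

/-- A tree in `G` with five branches, ending in the parts `A₁, A₂, B₀, B₁, B₂` of a set `A` of
vertices of the cycle `C`: the first two branches start at `u`, the third at `v` and the last two
at `z`, where `u` is joined to `v` and `v` to `z`. The tree is cheaper than any way to join `A`
in `C`, while proper subsets of `A` are joined in `C` as cheaply as in `G`. -/
structure FiveBranch (ℓ : β → ℝ) (G C : Graph α β) (A A₁ A₂ B₀ B₁ B₂ : Set α) (u v z : α)
    (a₁ a₂ ε b₀ δ b₁ b₂ t : ℝ) : Prop where
  union_eq : A₁ ∪ A₂ ∪ (B₀ ∪ (B₁ ∪ B₂)) = A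
  subset : A ⊆ V(C)
  nonempty_A₁ : A₁.Nonempty
  nonempty_A₂ : A₂.Nonempty
  nonempty_B₀ : B₀.Nonempty
  nonempty_B₁ : B₁.Nonempty
  nonempty_B₂ : B₂.Nonempty
  disjoint_A : Disjoint A₁ A₂
  disjoint : Disjoint (A₁ ∪ A₂) (B₀ ∪ (B₁ ∪ B₂))
  disjoint_B₀ : Disjoint B₀ (B₁ ∪ B₂)
  disjoint_B : Disjoint B₁ B₂
  joined_A₁ : Joined ℓ G (insert u A₁) a₁
  joined_A₂ : Joined ℓ G (insert u A₂) a₂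
  joined_uv : Joined ℓ G {u, v} ε
  joined_B₀ : Joined ℓ G (insert v B₀) b₀
  joined_vz : Joined ℓ G {v, z} δ
  joined_B₁ : Joined ℓ G (insert z B₁) b₁
  joined_B₂ : Joined ℓ G (insert z B₂) b₂
  sum_le : a₁ + a₂ + ε + b₀ + δ + b₁ + b₂ ≤ t
  transfer : ∀ B r, B ⊂ A → Joined ℓ G B r → Joined ℓ C B r
  not_joined : ¬ Joined ℓ C A t

lemma FiveBranch.swap_A (h : FiveBranch ℓ G C A A₁ A₂ B₀ B₁ B₂ u v z a₁ a₂ ε b₀ δ b₁ b₂ t) :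
    FiveBranch ℓ G C A A₂ A₁ B₀ B₁ B₂ u v z a₂ a₁ ε b₀ δ b₁ b₂ t :=
  { h with
    union_eq := by rw [Set.union_comm A₂]; exact h.union_eq
    disjoint_A := h.disjoint_A.symm
    disjoint := by rw [Set.union_comm A₂]; exact h.disjoint
    nonempty_A₁ := h.nonempty_A₂
    nonempty_A₂ := h.nonempty_A₁
    joined_A₁ := h.joined_A₂
    joined_A₂ := h.joined_A₁
    sum_le := by linarith [h.sum_le] }

lemma FiveBranch.swap_B (h : FiveBranch ℓ G C A A₁ A₂ B₀ B₁ B₂ u v z a₁ a₂ ε b₀ δ b₁ b₂ t) :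
    FiveBranch ℓ G C A A₁ A₂ B₀ B₂ B₁ u v z a₁ a₂ ε b₀ δ b₂ b₁ t :=
  { h with
    union_eq := by rw [Set.union_comm B₂]; exact h.union_eq
    disjoint_B₀ := by rw [Set.union_comm B₂]; exact h.disjoint_B₀
    disjoint_B := h.disjoint_B.symm
    disjoint := by rw [Set.union_comm B₂]; exact h.disjoint
    nonempty_B₁ := h.nonempty_B₂
    nonempty_B₂ := h.nonempty_B₁
    joined_B₁ := h.joined_B₂
    joined_B₂ := h.joined_B₁
    sum_le := by linarith [h.sum_le] }

/-- The costs of joining in the cycle those unions of branches that the argument uses. -/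
structure BranchCosts (ℓ : β → ℝ) (C : Graph α β) (A₁ A₂ B₀ B₁ B₂ : Set α)
    (a₁ a₂ ε b₀ δ b₁ b₂ : ℝ) : Prop where
  pos : 0 ≤ a₁ ∧ 0 ≤ a₂ ∧ 0 ≤ ε ∧ 0 ≤ b₀ ∧ 0 ≤ δ ∧ 0 ≤ b₁ ∧ 0 ≤ b₂
  joined_A₁ : Joined ℓ C A₁ a₁
  joined_A₂ : Joined ℓ C A₂ a₂
  joined_B₁ : Joined ℓ C B₁ b₁
  joined_B₂ : Joined ℓ C B₂ b₂
  joined_B₀ : Joined ℓ C B₀ b₀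
  joined_A₁A₂ : Joined ℓ C (A₁ ∪ A₂) (a₁ + a₂)
  joined_B₁B₂ : Joined ℓ C (B₁ ∪ B₂) (b₁ + b₂)
  joined_B₀B₁B₂ : Joined ℓ C (B₀ ∪ (B₁ ∪ B₂)) (b₀ + δ + (b₁ + b₂))
  joined_B₀A₁ : Joined ℓ C (B₀ ∪ A₁) (b₀ + ε + a₁)
  joined_B₁B₂A₂ : Joined ℓ C (B₁ ∪ B₂ ∪ A₂) (b₁ + b₂ + δ + ε + a₂)
  joined_not_B₀ : Joined ℓ C (A₁ ∪ A₂ ∪ (B₁ ∪ B₂)) (a₁ + a₂ + ε + δ + (b₁ + b₂))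
  joined_not_B₁ : Joined ℓ C (A₁ ∪ A₂ ∪ (B₀ ∪ B₂)) (a₁ + a₂ + ε + b₀ + δ + b₂)
  joined_not_B₂ : Joined ℓ C (A₁ ∪ A₂ ∪ (B₀ ∪ B₁)) (a₁ + a₂ + ε + b₀ + δ + b₁)
  joined_not_A₁ : Joined ℓ C (A₂ ∪ (B₀ ∪ (B₁ ∪ B₂))) (a₂ + ε + b₀ + δ + (b₁ + b₂))
  joined_not_A₂ : Joined ℓ C (A₁ ∪ (B₀ ∪ (B₁ ∪ B₂))) (a₁ + ε + b₀ + δ + (b₁ + b₂))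
  joined_not_B₁B₂ : Joined ℓ C (A₁ ∪ A₂ ∪ B₀) (a₁ + a₂ + ε + b₀)

/-- Each union is joined in `G` by the corresponding part of the tree. It omits a nonempty branch,
hence is a proper subset of `A`, and `transfer` applies. -/
lemma FiveBranch.costs (hℓ : IsLengthFunction G ℓ)
    (h : FiveBranch ℓ G C A A₁ A₂ B₀ B₁ B₂ u v z a₁ a₂ ε b₀ δ b₁ b₂ t) :
    BranchCosts ℓ C A₁ A₂ B₀ B₁ B₂ a₁ a₂ ε b₀ δ b₁ b₂ := by
  have hu := h.union_eq
  obtain ⟨x₁, hx₁⟩ := h.nonempty_A₁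
  obtain ⟨x₂, hx₂⟩ := h.nonempty_A₂
  obtain ⟨y₀, hy₀⟩ := h.nonempty_B₀
  obtain ⟨y₁, hy₁⟩ := h.nonempty_B₁
  obtain ⟨y₂, hy₂⟩ := h.nonempty_B₂
  have h1 := h.disjoint_A
  have h2 := h.disjoint
  have h3 := h.disjoint_B₀
  have h4 := h.disjoint_B
  simp only [Set.disjoint_union_left, Set.disjoint_union_right] at h2 h3
  obtain ⟨⟨e₁, e₂⟩, ⟨e₃, e₄⟩, e₅, e₆⟩ := h2
  have n₁ : x₁ ∉ A₂ ∧ x₁ ∉ B₀ ∧ x₁ ∉ B₁ ∧ x₁ ∉ B₂ :=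
    ⟨h1.notMem_of_mem_left hx₁, e₁.notMem_of_mem_left hx₁, e₃.notMem_of_mem_left hx₁,
      e₅.notMem_of_mem_left hx₁⟩
  have n₂ : x₂ ∉ A₁ ∧ x₂ ∉ B₀ ∧ x₂ ∉ B₁ ∧ x₂ ∉ B₂ :=
    ⟨h1.notMem_of_mem_right hx₂, e₂.notMem_of_mem_left hx₂, e₄.notMem_of_mem_left hx₂,
      e₆.notMem_of_mem_left hx₂⟩
  have q₀ : y₀ ∉ A₁ ∧ y₀ ∉ A₂ ∧ y₀ ∉ B₁ ∧ y₀ ∉ B₂ :=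
    ⟨e₁.notMem_of_mem_right hy₀, e₂.notMem_of_mem_right hy₀, h3.1.notMem_of_mem_left hy₀,
      h3.2.notMem_of_mem_left hy₀⟩
  have q₁ : y₁ ∉ A₁ ∧ y₁ ∉ A₂ ∧ y₁ ∉ B₀ ∧ y₁ ∉ B₂ :=
    ⟨e₃.notMem_of_mem_right hy₁, e₄.notMem_of_mem_right hy₁, h3.1.notMem_of_mem_right hy₁,
      h4.notMem_of_mem_left hy₁⟩
  have q₂ : y₂ ∉ A₁ ∧ y₂ ∉ A₂ ∧ y₂ ∉ B₀ ∧ y₂ ∉ B₁ :=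
    ⟨e₅.notMem_of_mem_right hy₂, e₆.notMem_of_mem_right hy₂, h3.2.notMem_of_mem_right hy₂,
      h4.notMem_of_mem_right hy₂⟩
  clear h1 e₁ e₂ e₃ e₄ e₅ e₆ h3 h4
  have m₁ : x₁ ∈ A := by rw [← hu]; simp only [Set.mem_union]; tauto
  have m₂ : x₂ ∈ A := by rw [← hu]; simp only [Set.mem_union]; tauto
  have k₀ : y₀ ∈ A := by rw [← hu]; simp only [Set.mem_union]; tauto
  have k₁ : y₁ ∈ A := by rw [← hu]; simp only [Set.mem_union]; tauto
  have k₂ : y₂ ∈ A := by rw [← hu]; simp only [Set.mem_union]; tauto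
  -- Here `x` is a terminal of an omitted branch, witnessing that `B` is proper.
  have key : ∀ {B B' r r'} (x : α), x ∈ A → x ∉ B → B ⊆ A → B ⊆ B' → r' ≤ r →
      Joined ℓ G B' r' → Joined ℓ C B r := fun x hx hxB hBA hBB' hr hj =>
    h.transfer _ _ ⟨hBA, fun hAB => hxB (hAB hx)⟩ (hj.mono hBB' hr)
  have jA : Joined ℓ G (insert u (A₁ ∪ A₂)) (a₁ + a₂) :=
    (h.joined_A₁.union hℓ h.joined_A₂ (x := u) (by simp) (by simp)).mono (by grind) le_rfl
  have jB : Joined ℓ G (insert z (B₁ ∪ B₂)) (b₁ + b₂) :=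
    (h.joined_B₁.union hℓ h.joined_B₂ (x := z) (by simp) (by simp)).mono (by grind) le_rfl
  have j0 : Joined ℓ G (insert u (insert v B₀)) (ε + b₀) :=
    (h.joined_uv.union hℓ h.joined_B₀ (x := v) (by simp) (by simp)).mono (by grind) le_rfl
  have ext : ∀ {B r}, Joined ℓ G (insert z B) r → Joined ℓ G (insert v B) (δ + r) :=
    fun hj => (h.joined_vz.union hℓ hj (x := z) (by simp) (by simp)).mono (by grind) le_rfl
  have at_v : ∀ {B B' r r'}, Joined ℓ G (insert v B) r → Joined ℓ G (insert v B') r' →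
      Joined ℓ G (insert v (B ∪ B')) (r + r') := fun hj hj' =>
    (hj.union hℓ hj' (x := v) (by simp) (by simp)).mono (by grind) le_rfl
  have ext' : ∀ {B r}, Joined ℓ G (insert u B) r → Joined ℓ G (insert v B) (ε + r) :=
    fun hj => (h.joined_uv.union hℓ hj (x := u) (by simp) (by simp)).mono (by grind) le_rfl
  have p1 := h.joined_A₁.nonneg hℓ
  have p2 := h.joined_A₂.nonneg hℓ
  have p3 := h.joined_uv.nonneg hℓ
  have p4 := h.joined_B₀.nonneg hℓ
  have p5 := h.joined_vz.nonneg hℓ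
  have p6 := h.joined_B₁.nonneg hℓ
  have p7 := h.joined_B₂.nonneg hℓ
  subst hu
  refine
    { pos := ⟨p1, p2, p3, p4, p5, p6, p7⟩
      joined_A₁ := key x₂ m₂ ?_ ?_ ?_ ?_ h.joined_A₁
      joined_A₂ := key x₁ m₁ ?_ ?_ ?_ ?_ h.joined_A₂
      joined_B₁ := key x₁ m₁ ?_ ?_ ?_ ?_ h.joined_B₁
      joined_B₂ := key x₁ m₁ ?_ ?_ ?_ ?_ h.joined_B₂
      joined_B₀ := key x₁ m₁ ?_ ?_ ?_ ?_ h.joined_B₀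
      joined_A₁A₂ := key y₀ k₀ ?_ ?_ ?_ ?_ jA
      joined_B₁B₂ := key y₀ k₀ ?_ ?_ ?_ ?_ jB
      joined_B₀B₁B₂ := key x₁ m₁ ?_ ?_ ?_ ?_ (at_v h.joined_B₀ (ext jB))
      joined_B₀A₁ := key x₂ m₂ ?_ ?_ ?_ ?_ (at_v h.joined_B₀ (ext' h.joined_A₁))
      joined_B₁B₂A₂ := key x₁ m₁ ?_ ?_ ?_ ?_ (at_v (ext jB) (ext' h.joined_A₂))
      joined_not_B₀ := key y₀ k₀ ?_ ?_ ?_ ?_ (at_v (ext' jA) (ext jB))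
      joined_not_B₁ := key y₁ k₁ ?_ ?_ ?_ ?_
        (at_v (ext' jA) (at_v h.joined_B₀ (ext h.joined_B₂)))
      joined_not_B₂ := key y₂ k₂ ?_ ?_ ?_ ?_
        (at_v (ext' jA) (at_v h.joined_B₀ (ext h.joined_B₁)))
      joined_not_A₁ := key x₁ m₁ ?_ ?_ ?_ ?_ (at_v (ext' h.joined_A₂) (at_v h.joined_B₀ (ext jB)))
      joined_not_A₂ := key x₂ m₂ ?_ ?_ ?_ ?_ (at_v (ext' h.joined_A₁) (at_v h.joined_B₀ (ext jB)))
      joined_not_B₁B₂ := key y₁ k₁ ?_ ?_ ?_ ?_ (at_v (ext' jA) h.joined_B₀) }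
  all_goals first
    | exact fun s hs => by
        clear * - hs; simp only [Set.mem_union, Set.mem_insert_iff] at hs ⊢; tauto
    | simp only [Set.mem_union, n₁, n₂, q₀, q₁, q₂, or_self, not_false_eq_true]
    | linarith

/-- The first and last index of a part of the cycle that avoids the base point. -/
lemma Frame.exists_first_last (h : Frame C n w d) {X : Set α} (hX : X ⊆ V(C)) (hne : X.Nonempty)
    (h0 : w 0 ∉ X) : ∃ p q, 0 < p ∧ p ≤ q ∧ q < n ∧ w p ∈ X ∧ w q ∈ X ∧
      ∀ i ≤ n, w i ∈ X → p ≤ i ∧ i ≤ q := by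
  classical
  obtain ⟨x, hx⟩ := hne
  obtain ⟨i, hi, rfl⟩ := h.exists_vertex x (hX hx)
  have hex : ∃ i, w i ∈ X := ⟨i, hx⟩
  have hp := Nat.find_spec hex
  have hq := Nat.findGreatest_spec (P := fun i => w i ∈ X) hi.le hx
  have hqn := Nat.findGreatest_le (P := fun i => w i ∈ X) n
  have hpos : Nat.find hex ≠ 0 := fun hh => h0 (hh ▸ hp)
  have hqn' : Nat.findGreatest (fun i => w i ∈ X) n ≠ n := fun hh => by
    rw [hh, h.wrap] at hq
    exact h0 hq
  exact ⟨_, _, Nat.pos_of_ne_zero hpos, Nat.find_min' hex hq, hqn.lt_of_ne hqn', hp, hq,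
    fun j hj hjX => ⟨Nat.find_min' hex hjX, Nat.le_findGreatest hj hjX⟩⟩

end FiveBranch

/-! ### The cyclic order of the five branches -/

section FiveBranch

variable {α β : Type*} {G C : Graph α β} {ℓ : β → ℝ} {A A₁ A₂ B₀ B₁ B₂ : Set α}
  {u v z : α} {a₁ a₂ b₀ b₁ b₂ ε δ t : ℝ} {n : ℕ} {w : ℕ → α} {d : ℕ → β}

/-- The five branches occupy consecutive intervals of indices, in the order
`B₀, B₁, B₂, A₁, A₂, B₀`; the first and last interval together form `B₀`. -/
structure Layout (n : ℕ) (w : ℕ → α) (A A₁ A₂ B₀ B₁ B₂ : Set α)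
    (f c c' k k' a a' b b' g : ℕ) : Prop where
  lt : f < c ∧ c ≤ c' ∧ c' < k ∧ k ≤ k' ∧ k' < a ∧ a ≤ a' ∧ a' < b ∧ b ≤ b' ∧ b' < g ∧ g ≤ n
  mem_f : w f ∈ B₀
  mem_c : w c ∈ B₁
  mem_c' : w c' ∈ B₁
  mem_k : w k ∈ B₂
  mem_k' : w k' ∈ B₂
  mem_a : w a ∈ A₁
  mem_a' : w a' ∈ A₁
  mem_b : w b ∈ A₂
  mem_b' : w b' ∈ A₂
  mem_g : w g ∈ B₀
  locate : ∀ i ≤ n, w i ∈ A → (i ≤ f ∨ g ≤ i) ∧ w i ∈ B₀ ∨ (c ≤ i ∧ i ≤ c') ∧ w i ∈ B₁ ∨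
    (k ≤ i ∧ i ≤ k') ∧ w i ∈ B₂ ∨ (a ≤ i ∧ i ≤ a') ∧ w i ∈ A₁ ∨ (b ≤ i ∧ i ≤ b') ∧ w i ∈ A₂

/-- Since the base point lies in `B₀`, the other four branches are intervals of indices with a first
and a last element. Only `B₀` wraps around the base point, so its ends `f` and `g` are its last
index before `B₁` and its first index after `A₂`; the latter exists because `w n = w 0`. -/
lemma FiveBranch.exists_layout
    (h : FiveBranch ℓ G C A A₁ A₂ B₀ B₁ B₂ u v z a₁ a₂ ε b₀ δ b₁ b₂ t) (hf : Frame C n w d)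
    (h0 : w 0 ∈ B₀)
    (hB : ∀ i ≤ n, ∀ j ≤ n, w i ∈ B₁ → w j ∈ B₂ → i < j)
    (hBA : ∀ i ≤ n, ∀ j ≤ n, w i ∈ B₁ ∪ B₂ → w j ∈ A₁ ∪ A₂ → i < j)
    (hA : ∀ i ≤ n, ∀ j ≤ n, w i ∈ A₁ → w j ∈ A₂ → i < j)
    (hB₀ : ∀ i j i', i ≤ j → j ≤ i' → i' ≤ n → w i ∈ A₁ ∪ A₂ ∪ (B₁ ∪ B₂) →
      w i' ∈ A₁ ∪ A₂ ∪ (B₁ ∪ B₂) → w j ∉ B₀) :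
    ∃ f c c' k k' a a' b b' g, Layout n w A A₁ A₂ B₀ B₁ B₂ f c c' k k' a a' b b' g := by
  classical
  have h2 := h.disjoint
  have h3 := h.disjoint_B₀
  simp only [Set.disjoint_union_left, Set.disjoint_union_right] at h2 h3
  have hAC := h.subset
  rw [← h.union_eq] at hAC
  simp only [Set.union_subset_iff] at hAC
  obtain ⟨c, c', hc0, hcc, hcn, hc, hc', hcl⟩ := hf.exists_first_last hAC.2.2.1 h.nonempty_B₁
    (h3.1.notMem_of_mem_left h0)
  obtain ⟨k, k', hk0, hkk, hkn, hk, hk', hkl⟩ := hf.exists_first_last hAC.2.2.2 h.nonempty_B₂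
    (h3.2.notMem_of_mem_left h0)
  obtain ⟨a, a', ha0, haa, han, ha, ha', hal⟩ := hf.exists_first_last hAC.1.1 h.nonempty_A₁
    (h2.1.1.notMem_of_mem_right h0)
  obtain ⟨b, b', hb0, hbb, hbn, hb, hb', hbl⟩ := hf.exists_first_last hAC.1.2 h.nonempty_A₂
    (h2.1.2.notMem_of_mem_right h0)
  have hck := hB c' (by lia) k (by lia) hc' hk
  have hka := hBA k' (by lia) a (by lia) (.inr hk') (.inl ha)
  have hab := hA a' (by lia) b (by lia) ha' hb
  have hfle := Nat.findGreatest_le (P := fun i => w i ∈ B₀) c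
  have hfm := Nat.findGreatest_spec (P := fun i => w i ∈ B₀) (Nat.zero_le c) h0
  have hfg : ∀ i ≤ c, w i ∈ B₀ → i ≤ Nat.findGreatest (fun i => w i ∈ B₀) c :=
    fun i hi hiB => Nat.le_findGreatest hi hiB
  set f := Nat.findGreatest (fun i => w i ∈ B₀) c
  have hgex : ∃ i, b' < i ∧ w i ∈ B₀ := ⟨n, hbn, by rwa [hf.wrap]⟩
  obtain ⟨hg1, hg2⟩ := Nat.find_spec hgex
  have hgl : ∀ i, b' < i → w i ∈ B₀ → Nat.find hgex ≤ i :=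
    fun i hi hiB => Nat.find_min' hgex ⟨hi, hiB⟩
  set g := Nat.find hgex
  have hgn : g ≤ n := hgl n hbn (by rwa [hf.wrap])
  have hfc : f ≠ c := fun hh => h3.1.notMem_of_mem_left hfm (hh ▸ hc)
  refine ⟨f, c, c', k, k', a, a', b, b', g, ⟨by lia, hfm, hc, hc', hk, hk', ha, ha', hb, hb',
    hg2, fun i hi hiA => ?_⟩⟩
  rw [← h.union_eq] at hiA
  rcases hiA with (hiA | hiA) | hiA | hiA | hiA
  · exact .inr (.inr (.inr (.inl ⟨hal i hi hiA, hiA⟩)))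
  · exact .inr (.inr (.inr (.inr ⟨hbl i hi hiA, hiA⟩)))
  · refine .inl ⟨?_, hiA⟩
    rcases le_or_gt i c with hic | hic
    · exact .inl (hfg i hic hiA)
    · rcases le_or_gt i b' with hib | hib
      · exact absurd hiA (hB₀ c i b' hic.le hib hbn.le (.inr (.inl hc)) (.inl (.inr hb')))
      · exact .inr (hgl i hib hiA)
  · exact .inr (.inl ⟨hcl i hi hiA, hiA⟩)
  · exact .inr (.inr (.inl ⟨hkl i hi hiA, hiA⟩))

/-- The possible positions of a cut `j` between neighbouring indices `x` and `y`. -/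
lemma Layout.cut_cases {f c c' k k' a a' b b' g : ℕ}
    (h : Layout n w A A₁ A₂ B₀ B₁ B₂ f c c' k k' a a' b b' g)
    (hu : A₁ ∪ A₂ ∪ (B₀ ∪ (B₁ ∪ B₂)) = A) {j x y : ℕ} (hxj : x ≤ j) (hjy : j < y) (hy : y ≤ n)
    (hxA : w x ∈ A) (hyA : w y ∈ A) (hno : ∀ i, x < i → i < y → w i ∉ A) :
    (j < f ∨ g ≤ j) ∧ w x ∈ B₀ ∧ w y ∈ B₀ ∨ (f ≤ j ∧ j < c) ∧ w x ∈ B₀ ∧ w y ∈ B₁ ∨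
    (c ≤ j ∧ j < c') ∧ w x ∈ B₁ ∧ w y ∈ B₁ ∨ (c' ≤ j ∧ j < k) ∧ w x ∈ B₁ ∧ w y ∈ B₂ ∨
    (k ≤ j ∧ j < k') ∧ w x ∈ B₂ ∧ w y ∈ B₂ ∨ (k' ≤ j ∧ j < a) ∧ w x ∈ B₂ ∧ w y ∈ A₁ ∨
    (a ≤ j ∧ j < a') ∧ w x ∈ A₁ ∧ w y ∈ A₁ ∨ (a' ≤ j ∧ j < b) ∧ w x ∈ A₁ ∧ w y ∈ A₂ ∨
    (b ≤ j ∧ j < b') ∧ w x ∈ A₂ ∧ w y ∈ A₂ ∨ (b' ≤ j ∧ j < g) ∧ w x ∈ A₂ ∧ w y ∈ B₀ := by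
  have hlt := h.lt
  have key : ∀ i, w i ∈ A → i ≤ x ∨ y ≤ i := fun i hi => by
    by_contra! hcon
    exact hno i hcon.1 hcon.2 hi
  subst hu
  have kf := key f (.inr (.inl h.mem_f))
  have kc := key c (.inr (.inr (.inl h.mem_c)))
  have kc' := key c' (.inr (.inr (.inl h.mem_c')))
  have kk := key k (.inr (.inr (.inr h.mem_k)))
  have kk' := key k' (.inr (.inr (.inr h.mem_k')))
  have ka := key a (.inl (.inl h.mem_a))
  have ka' := key a' (.inl (.inl h.mem_a'))
  have kb := key b (.inl (.inr h.mem_b))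
  have kb' := key b' (.inl (.inr h.mem_b'))
  have kg := key g (.inr (.inl h.mem_g))
  rcases h.locate x (by lia) hxA with ⟨hx, hx'⟩ | ⟨hx, hx'⟩ | ⟨hx, hx'⟩ | ⟨hx, hx'⟩ | ⟨hx, hx'⟩ <;>
  rcases h.locate y hy hyA with ⟨hy, hy'⟩ | ⟨hy, hy'⟩ | ⟨hy, hy'⟩ | ⟨hy, hy'⟩ | ⟨hy, hy'⟩ <;>
  first
  | exact absurd hx (by lia)
  | exact .inl ⟨by lia, hx', hy'⟩
  | exact .inr (.inl ⟨by lia, hx', hy'⟩)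
  | exact .inr (.inr (.inl ⟨by lia, hx', hy'⟩))
  | exact .inr (.inr (.inr (.inl ⟨by lia, hx', hy'⟩)))
  | exact .inr (.inr (.inr (.inr (.inl ⟨by lia, hx', hy'⟩))))
  | exact .inr (.inr (.inr (.inr (.inr (.inl ⟨by lia, hx', hy'⟩)))))
  | exact .inr (.inr (.inr (.inr (.inr (.inr (.inl ⟨by lia, hx', hy'⟩))))))
  | exact .inr (.inr (.inr (.inr (.inr (.inr (.inr (.inl ⟨by lia, hx', hy'⟩)))))))
  | exact .inr (.inr (.inr (.inr (.inr (.inr (.inr (.inr (.inl ⟨by lia, hx', hy'⟩))))))))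
  | exact .inr (.inr (.inr (.inr (.inr (.inr (.inr (.inr (.inr ⟨by lia, hx', hy'⟩))))))))

end FiveBranch

/-! ### The strict inequality for branches in a fixed order -/

section FiveBranch

variable {α β : Type*} {G C : Graph α β} {ℓ : β → ℝ} {A A₁ A₂ B₀ B₁ B₂ : Set α}
  {u v z : α} {a₁ a₂ b₀ b₁ b₂ ε δ t : ℝ} {n : ℕ} {w : ℕ → α} {d : ℕ → β}

/-- A set that contains some of the branches and is joined at cost less than `A` is cut outside
those branches and outside the gaps between neighbouring ones. -/
lemma FiveBranch.exists_cut (hℓ : IsLengthFunction C ℓ)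
    (h : FiveBranch ℓ G C A A₁ A₂ B₀ B₁ B₂ u v z a₁ a₂ ε b₀ δ b₁ b₂ t) (hf : Frame C n w d)
    (h0 : w 0 ∈ B₀) {f c c' k k' a a' b b' g : ℕ}
    (hl : Layout n w A A₁ A₂ B₀ B₁ B₂ f c c' k k' a a' b b' g) {B : Set α} {r : ℝ}
    (hB : Joined ℓ C B r) (hr : r ≤ t) :
    ∃ j, ((B₀ ⊆ B → ¬ (j < f ∨ g ≤ j)) ∧ (B₁ ⊆ B → ¬ (c ≤ j ∧ j < c')) ∧
      (B₂ ⊆ B → ¬ (k ≤ j ∧ j < k')) ∧ (A₁ ⊆ B → ¬ (a ≤ j ∧ j < a')) ∧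
      (A₂ ⊆ B → ¬ (b ≤ j ∧ j < b')) ∧ (B₀ ⊆ B → B₁ ⊆ B → ¬ (f ≤ j ∧ j < c)) ∧
      (B₁ ⊆ B → B₂ ⊆ B → ¬ (c' ≤ j ∧ j < k)) ∧ (B₂ ⊆ B → A₁ ⊆ B → ¬ (k' ≤ j ∧ j < a)) ∧
      (A₁ ⊆ B → A₂ ⊆ B → ¬ (a' ≤ j ∧ j < b)) ∧ (A₂ ⊆ B → B₀ ⊆ B → ¬ (b' ≤ j ∧ j < g))) ∧
      ∀ x y, x ≤ y → y ≤ n → w x ∈ B → w y ∈ B →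
      (x ≤ j → j < y →
        prefixLength ℓ d n - (prefixLength ℓ d y - prefixLength ℓ d x) ≤ r) ∧
      (y ≤ j ∨ j < x → prefixLength ℓ d y - prefixLength ℓ d x ≤ r) := by
  obtain ⟨j, x, y, hxj, hjy, hy, hx, hyA, hno, hnb, hcut⟩ :=
    hf.exists_cut_of_not_joined hℓ h.subset (h.union_eq ▸ .inr (.inl h0)) h.not_joined hB hr
  refine ⟨j, ?_, hcut⟩
  have hlt := hl.lt
  rcases hl.cut_cases h.union_eq hxj hjy hy hx hyA hno with ⟨hj, h1, h2⟩ | ⟨hj, h1, h2⟩ |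
    ⟨hj, h1, h2⟩ | ⟨hj, h1, h2⟩ | ⟨hj, h1, h2⟩ | ⟨hj, h1, h2⟩ | ⟨hj, h1, h2⟩ | ⟨hj, h1, h2⟩ |
    ⟨hj, h1, h2⟩ | ⟨hj, h1, h2⟩ <;>
  refine ⟨fun s1 hh => ?_, fun s1 hh => ?_, fun s1 hh => ?_, fun s1 hh => ?_, fun s1 hh => ?_,
    fun s1 s2 hh => ?_, fun s1 s2 hh => ?_, fun s1 s2 hh => ?_, fun s1 s2 hh => ?_,
    fun s1 s2 hh => ?_⟩ <;>
  first
  | exact hnb ⟨s1 h1, s1 h2⟩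
  | exact hnb ⟨s1 h1, s2 h2⟩
  | lia

/-- Let `D = s n - t`; every gap between neighbouring branches is shorter than `D`. A union of
branches whose cost is at most `t` is cut outside those branches and the gaps between them, so one
of few arcs must be affordable. The witness is the length of the arc spanning `A₁ ∪ A₂`. Were `B₀ ∪
B₁ ∪ B₂` joined at that cost, its spanning arc would be no longer, contradicting the bounds on
partial unions. -/
lemma FiveBranch.lt_of_layout (hℓ : IsLengthFunction G ℓ) (hCG : C ≤ G)
    (h : FiveBranch ℓ G C A A₁ A₂ B₀ B₁ B₂ u v z a₁ a₂ ε b₀ δ b₁ b₂ t) (hf : Frame C n w d)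
    (h0 : w 0 ∈ B₀) {f c c' k k' a a' b b' g : ℕ}
    (hl : Layout n w A A₁ A₂ B₀ B₁ B₂ f c c' k k' a a' b b' g) :
    ∃ r, Joined ℓ C (A₁ ∪ A₂) r ∧ ¬ Joined ℓ C (B₀ ∪ (B₁ ∪ B₂)) r := by
  have hℓC := hℓ.of_le hCG
  have hco := h.costs hℓ
  obtain ⟨p1, p2, p3, p4, p5, p6, p7⟩ := hco.pos
  have hsum := h.sum_le
  have hlt := hl.lt
  have hu := h.union_eq
  have mf := hl.mem_f
  have mc := hl.mem_c
  have mc' := hl.mem_c'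
  have mk := hl.mem_k
  have mk' := hl.mem_k'
  have ma := hl.mem_a
  have ma' := hl.mem_a'
  have mb := hl.mem_b
  have mb' := hl.mem_b'
  have mg := hl.mem_g
  set s := prefixLength ℓ d with hs
  have gap : ∀ x y, x ≤ y → y ≤ n → (∀ i, x < i → i < y → ¬ (i ≤ f ∨ g ≤ i) ∧ ¬ (c ≤ i ∧ i ≤ c') ∧
      ¬ (k ≤ i ∧ i ≤ k') ∧ ¬ (a ≤ i ∧ i ≤ a') ∧ ¬ (b ≤ i ∧ i ≤ b')) → t < s n - (s y - s x) := by
    intro x y hxy hy hno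
    refine hf.gap_lt h.subset h.not_joined hxy hy fun i hi hiy hiA => ?_
    obtain ⟨n1, n2, n3, n4, n5⟩ := hno i hi hiy
    rcases hl.locate i (by lia) hiA with hh | hh | hh | hh | hh
    exacts [n1 hh.1, n2 hh.1, n3 hh.1, n4 hh.1, n5 hh.1]
  have g1 := gap f c (by lia) (by lia) (by lia)
  have g2 := gap c' k (by lia) (by lia) (by lia)
  have g3 := gap k' a (by lia) (by lia) (by lia)
  have g4 := gap a' b (by lia) (by lia) (by lia)
  have g5 := gap b' g (by lia) (by lia) (by lia)
  have mono : ∀ x y, x ≤ y → y ≤ n → s x ≤ s y := fun x y => hf.prefixLength_mono hℓC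
  have o0 := mono 0 f (by lia) (by lia)
  have o1 := mono f c (by lia) (by lia)
  have o2 := mono c c' (by lia) (by lia)
  have o3 := mono c' k (by lia) (by lia)
  have o4 := mono k k' (by lia) (by lia)
  have o5 := mono k' a (by lia) (by lia)
  have o6 := mono a a' (by lia) (by lia)
  have o7 := mono a' b (by lia) (by lia)
  have o8 := mono b b' (by lia) (by lia)
  have o9 := mono b' g (by lia) (by lia)
  have o10 := mono g n (by lia) (by lia)
  have hs0 : s 0 = 0 := by simp [hs, prefixLength]
  have e1 : s b' - s a ≤ a₁ + a₂ := by
    obtain ⟨j, ⟨z0, z1, z2, z3, z4, z5, z6, z7, z8, z9⟩, hcut⟩ :=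
      h.exists_cut hℓC hf h0 hl hco.joined_A₁A₂ (by linarith)
    have : b' ≤ j ∨ j < a := by
      have := z3 (fun _ hx => .inl hx)
      have := z4 (fun _ hx => .inr hx)
      have := z8 (fun _ hx => .inl hx) (fun _ hx => .inr hx)
      lia
    exact (hcut a b' (by lia) (by lia) (.inl ma) (.inr mb')).2 this
  have e2 : ∀ r ≤ t, Joined ℓ C (B₀ ∪ (B₁ ∪ B₂)) r → s n - (s g - s k') ≤ r := by
    intro r hr hj
    obtain ⟨j, ⟨z0, z1, z2, z3, z4, z5, z6, z7, z8, z9⟩, hcut⟩ :=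
      h.exists_cut hℓC hf h0 hl hj hr
    have : k' ≤ j ∧ j < g := by
      have := z0 (fun _ hx => .inl hx)
      have := z1 (fun _ hx => .inr (.inl hx))
      have := z2 (fun _ hx => .inr (.inr hx))
      have := z5 (fun _ hx => .inl hx) (fun _ hx => .inr (.inl hx))
      have := z6 (fun _ hx => .inr (.inl hx)) (fun _ hx => .inr (.inr hx))
      lia
    exact (hcut k' g (by lia) (by lia) (.inr (.inr mk')) (.inl mg)).1 this.1 this.2
  have e3 : s n - (s a - s f) ≤ b₀ + ε + a₁ ∨ s n - (s g - s a') ≤ b₀ + ε + a₁ := by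
    obtain ⟨j, ⟨z0, z1, z2, z3, z4, z5, z6, z7, z8, z9⟩, hcut⟩ :=
      h.exists_cut hℓC hf h0 hl hco.joined_B₀A₁ (by linarith)
    have : (f ≤ j ∧ j < a) ∨ (a' ≤ j ∧ j < g) := by
      have := z0 (fun _ hx => .inl hx)
      have := z3 (fun _ hx => .inr hx)
      lia
    exact this.imp
      (fun hj => (hcut f a (by lia) (by lia) (.inl mf) (.inr ma)).1 hj.1 hj.2)
      (fun hj => (hcut a' g (by lia) (by lia) (.inr ma') (.inl mg)).1 hj.1 hj.2)
  have e4 : s n - (s b - s k') ≤ b₁ + b₂ + δ + ε + a₂ ∨ s b' - s c ≤ b₁ + b₂ + δ + ε + a₂ := by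
    obtain ⟨j, ⟨z0, z1, z2, z3, z4, z5, z6, z7, z8, z9⟩, hcut⟩ :=
      h.exists_cut hℓC hf h0 hl hco.joined_B₁B₂A₂ (by linarith)
    have : (k' ≤ j ∧ j < b) ∨ (b' ≤ j ∨ j < c) := by
      have := z1 (fun _ hx => .inl (.inl hx))
      have := z2 (fun _ hx => .inl (.inr hx))
      have := z4 (fun _ hx => .inr hx)
      have := z6 (fun _ hx => .inl (.inl hx)) (fun _ hx => .inl (.inr hx))
      lia
    exact this.imp
      (fun hj => (hcut k' b (by lia) (by lia) (.inl (.inr mk')) (.inr mb)).1 hj.1 hj.2)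
      (fun hj => (hcut c b' (by lia) (by lia) (.inl (.inl mc)) (.inr mb')).2 hj)
  have e5 : s k' - s c ≤ b₁ + b₂ := by
    obtain ⟨j, ⟨z0, z1, z2, z3, z4, z5, z6, z7, z8, z9⟩, hcut⟩ :=
      h.exists_cut hℓC hf h0 hl hco.joined_B₁B₂ (by linarith)
    have : k' ≤ j ∨ j < c := by
      have := z1 (fun _ hx => .inl hx)
      have := z2 (fun _ hx => .inr hx)
      have := z6 (fun _ hx => .inl hx) (fun _ hx => .inr hx)
      lia
    exact (hcut c k' (by lia) (by lia) (.inl mc) (.inr mk')).2 this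
  have e6 : s n - (s k - s f) ≤ a₁ + a₂ + ε + b₀ + δ + b₂ := by
    obtain ⟨j, ⟨z0, z1, z2, z3, z4, z5, z6, z7, z8, z9⟩, hcut⟩ :=
      h.exists_cut hℓC hf h0 hl hco.joined_not_B₁ (by linarith)
    have : f ≤ j ∧ j < k := by
      have := z0 (fun _ hx => .inr (.inl hx))
      have := z2 (fun _ hx => .inr (.inr hx))
      have := z3 (fun _ hx => .inl (.inl hx))
      have := z4 (fun _ hx => .inl (.inr hx))
      have := z7 (fun _ hx => .inr (.inr hx)) (fun _ hx => .inl (.inl hx))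
      have := z8 (fun _ hx => .inl (.inl hx)) (fun _ hx => .inl (.inr hx))
      have := z9 (fun _ hx => .inl (.inr hx)) (fun _ hx => .inr (.inl hx))
      lia
    exact (hcut f k (by lia) (by lia) (.inr (.inl mf)) (.inr (.inr mk))).1 this.1 this.2
  have e7 : s n - (s a - s c') ≤ a₁ + a₂ + ε + b₀ + δ + b₁ := by
    obtain ⟨j, ⟨z0, z1, z2, z3, z4, z5, z6, z7, z8, z9⟩, hcut⟩ :=
      h.exists_cut hℓC hf h0 hl hco.joined_not_B₂ (by linarith)
    have : c' ≤ j ∧ j < a := by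
      have := z0 (fun _ hx => .inr (.inl hx))
      have := z1 (fun _ hx => .inr (.inr hx))
      have := z3 (fun _ hx => .inl (.inl hx))
      have := z4 (fun _ hx => .inl (.inr hx))
      have := z5 (fun _ hx => .inr (.inl hx)) (fun _ hx => .inr (.inr hx))
      have := z8 (fun _ hx => .inl (.inl hx)) (fun _ hx => .inl (.inr hx))
      have := z9 (fun _ hx => .inl (.inr hx)) (fun _ hx => .inr (.inl hx))
      lia
    exact (hcut c' a (by lia) (by lia) (.inr (.inr mc')) (.inl (.inl ma))).1 this.1 this.2
  refine ⟨s b' - s a, hf.joined_arc (by lia) (by lia) ?_, fun hj => ?_⟩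
  · intro x hx
    have hxA : x ∈ A := hu ▸ .inl hx
    obtain ⟨i, hi, rfl⟩ := hf.exists_vertex x (h.subset hxA)
    have hd := h.disjoint.notMem_of_mem_left hx
    rcases hl.locate i hi.le hxA with hh | hh | hh | hh | hh
    · exact absurd (.inl hh.2) hd
    · exact absurd (.inr (.inl hh.2)) hd
    · exact absurd (.inr (.inr hh.2)) hd
    · exact ⟨i, by lia, by lia, rfl⟩
    · exact ⟨i, by lia, by lia, rfl⟩
  · have e8 := e2 _ (by linarith) hj
    have e2' := e2 _ (by linarith) hco.joined_B₀B₁B₂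
    -- By `e1` and `e2'`, the gaps `B₂|A₁` and `A₂|B₀` sum to at least `D + ε`, so each exceeds `ε`,
    -- and `ε < D`. The bounds chosen from `e3` and `e4` have right sides summing to at most `t +
    -- ε`. First/first and second/second: the two arcs miss only the gap `B₂|A₁` (respectively
    -- `A₂|B₀`) and cover the other of these two gaps twice, making it shorter than `ε`.
    -- First/second: they miss only the gap `B₀|B₁` and cover the arc of `A₁ ∪ A₂` twice, so this
    -- arc is shorter than that gap, against `e8`. Only this case needs `e8`. Second/first: they
    -- miss only the gap `A₁|A₂` and cover the arc of `B₀ ∪ B₁ ∪ B₂` twice, so this arc is shorter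
    -- than `ε < D`. But `e5`, `e6`, `e7` make the gaps `B₀|B₁`, `B₁|B₂`, `B₂|A₁` sum to at least
    -- `2D`, so the first two, both inside the arc, exceed `D` together.
    rcases e3 with e3 | e3 <;> rcases e4 with e4 | e4 <;> linarith

end FiveBranch

/-! ### Reduction of all branch orders to the fixed one -/

section FiveBranch

variable {α β : Type*} {G C : Graph α β} {ℓ : β → ℝ} {A A₁ A₂ B₀ B₁ B₂ X Y : Set α}
  {u v z : α} {a₁ a₂ b₀ b₁ b₂ ε δ t : ℝ} {n : ℕ} {w : ℕ → α} {d : ℕ → β}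

lemma lt_or_gt_of_convex
    (hX : ∀ i j i', i ≤ j → j ≤ i' → i' ≤ n → w i ∈ X → w i' ∈ X → w j ∉ Y)
    (hY : ∀ i j i', i ≤ j → j ≤ i' → i' ≤ n → w i ∈ Y → w i' ∈ Y → w j ∉ X) :
    (∀ i ≤ n, ∀ j ≤ n, w i ∈ X → w j ∈ Y → i < j) ∨
      (∀ i ≤ n, ∀ j ≤ n, w i ∈ Y → w j ∈ X → i < j) := by
  by_contra! hcon
  obtain ⟨⟨i, hi, j, hj, hiX, hjY, hji⟩, i', hi', j', hj', hiY', hjX', hji'⟩ := hcon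
  rcases le_total j' j with h | h
  · exact hX j' j i h hji hi hjX' hiX hjY
  · exact hY j j' i' h hji' hi' hjY hiY' hjX'

/-- The conclusion is symmetric in `A₁, A₂` and in `B₁, B₂`, so either pair may be renamed to obtain
the standard order. -/
lemma FiveBranch.exists_lt_of_frame (hℓ : IsLengthFunction G ℓ) (hCG : C ≤ G)
    (h : FiveBranch ℓ G C A A₁ A₂ B₀ B₁ B₂ u v z a₁ a₂ ε b₀ δ b₁ b₂ t) (hf : Frame C n w d)
    (h0 : w 0 ∈ B₀)
    (hB : (∀ i ≤ n, ∀ j ≤ n, w i ∈ B₁ → w j ∈ B₂ → i < j) ∨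
      (∀ i ≤ n, ∀ j ≤ n, w i ∈ B₂ → w j ∈ B₁ → i < j))
    (hBA : ∀ i ≤ n, ∀ j ≤ n, w i ∈ B₁ ∪ B₂ → w j ∈ A₁ ∪ A₂ → i < j)
    (hA : (∀ i ≤ n, ∀ j ≤ n, w i ∈ A₁ → w j ∈ A₂ → i < j) ∨
      (∀ i ≤ n, ∀ j ≤ n, w i ∈ A₂ → w j ∈ A₁ → i < j))
    (hB₀ : ∀ i j i', i ≤ j → j ≤ i' → i' ≤ n → w i ∈ A₁ ∪ A₂ ∪ (B₁ ∪ B₂) →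
      w i' ∈ A₁ ∪ A₂ ∪ (B₁ ∪ B₂) → w j ∉ B₀) :
    ∃ r, Joined ℓ C (A₁ ∪ A₂) r ∧ ¬ Joined ℓ C (B₀ ∪ (B₁ ∪ B₂)) r := by
  rcases hB with hB | hB <;> rcases hA with hA | hA
  · obtain ⟨f, c, c', k, k', a, a', b, b', g, hl⟩ := h.exists_layout hf h0 hB hBA hA hB₀
    exact h.lt_of_layout hℓ hCG hf h0 hl
  · rw [Set.union_comm A₁] at hBA hB₀ ⊢
    obtain ⟨f, c, c', k, k', a, a', b, b', g, hl⟩ := h.swap_A.exists_layout hf h0 hB hBA hA hB₀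
    exact h.swap_A.lt_of_layout hℓ hCG hf h0 hl
  · rw [Set.union_comm B₁] at hBA hB₀ ⊢
    obtain ⟨f, c, c', k, k', a, a', b, b', g, hl⟩ := h.swap_B.exists_layout hf h0 hB hBA hA hB₀
    exact h.swap_B.lt_of_layout hℓ hCG hf h0 hl
  · rw [Set.union_comm A₁, Set.union_comm B₁] at hBA hB₀ ⊢
    obtain ⟨f, c, c', k, k', a, a', b, b', g, hl⟩ :=
      h.swap_A.swap_B.exists_layout hf h0 hB hBA hA hB₀
    exact h.swap_A.swap_B.lt_of_layout hℓ hCG hf h0 hl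

/-- The base point lies in `Y`, so a point of `Y` between two points of `X` would make the two parts
cross. -/
lemma FiveBranch.convex (hℓ : IsLengthFunction C ℓ)
    (h : FiveBranch ℓ G C A A₁ A₂ B₀ B₁ B₂ u v z a₁ a₂ ε b₀ δ b₁ b₂ t) (hf : Frame C n w d)
    (h0 : w 0 ∈ Y) {rX rY : ℝ} (hX : Joined ℓ C X rX) (hY : Joined ℓ C Y rY) (hr : rX + rY ≤ t)
    (hXY : X ∪ Y = A) : ∀ i j i', i ≤ j → j ≤ i' → i' ≤ n → w i ∈ X → w i' ∈ X → w j ∉ Y := by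
  intro i j i' hij hji hi hiX hiX' hjY
  rw [Set.union_comm] at hXY
  exact hf.not_crossing hℓ hY hX (by linarith) (hXY ▸ h.not_joined) (Nat.zero_le i) hij hji hi
    h0 hiX hjY hiX'

lemma FiveBranch.exists_lt (hℓ : IsLengthFunction G ℓ) (hCG : C ≤ G) (hC : IsCycle C)
    (h : FiveBranch ℓ G C A A₁ A₂ B₀ B₁ B₂ u v z a₁ a₂ ε b₀ δ b₁ b₂ t) :
    ∃ r, Joined ℓ C (A₁ ∪ A₂) r ∧ ¬ Joined ℓ C (B₀ ∪ (B₁ ∪ B₂)) r := by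
  have hℓC := hℓ.of_le hCG
  have hco := h.costs hℓ
  obtain ⟨p1, p2, p3, p4, p5, p6, p7⟩ := hco.pos
  have hsum := h.sum_le
  have hu := h.union_eq
  obtain ⟨x, hx⟩ := h.nonempty_B₀
  have main : ∀ {n : ℕ} {w : ℕ → α} {d : ℕ → β}, Frame C n w d → w 0 = x →
      ((∀ i ≤ n, ∀ j ≤ n, w i ∈ B₁ → w j ∈ B₂ → i < j) ∨
        (∀ i ≤ n, ∀ j ≤ n, w i ∈ B₂ → w j ∈ B₁ → i < j)) ∧
      ((∀ i ≤ n, ∀ j ≤ n, w i ∈ B₁ ∪ B₂ → w j ∈ A₁ ∪ A₂ → i < j) ∨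
        (∀ i ≤ n, ∀ j ≤ n, w i ∈ A₁ ∪ A₂ → w j ∈ B₁ ∪ B₂ → i < j)) ∧
      ((∀ i ≤ n, ∀ j ≤ n, w i ∈ A₁ → w j ∈ A₂ → i < j) ∨
        (∀ i ≤ n, ∀ j ≤ n, w i ∈ A₂ → w j ∈ A₁ → i < j)) ∧
      (∀ i j i', i ≤ j → j ≤ i' → i' ≤ n → w i ∈ A₁ ∪ A₂ ∪ (B₁ ∪ B₂) →
        w i' ∈ A₁ ∪ A₂ ∪ (B₁ ∪ B₂) → w j ∉ B₀) := by
    intro n w d hf h0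
    have hw : w 0 ∈ B₀ := h0 ▸ hx
    have cB₁ := h.convex hℓC hf (.inr (.inl hw)) hco.joined_B₁ hco.joined_not_B₁ (by linarith)
      (by rw [← hu]; clear * -; grind)
    have cB₂ := h.convex hℓC hf (.inr (.inl hw)) hco.joined_B₂ hco.joined_not_B₂ (by linarith)
      (by rw [← hu]; clear * -; grind)
    have cA₁ := h.convex hℓC hf (.inr (.inl hw)) hco.joined_A₁ hco.joined_not_A₁ (by linarith)
      (by rw [← hu]; clear * -; grind)
    have cA₂ := h.convex hℓC hf (.inr (.inl hw)) hco.joined_A₂ hco.joined_not_A₂ (by linarith)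
      (by rw [← hu]; clear * -; grind)
    have cA := h.convex hℓC hf (.inl hw) hco.joined_A₁A₂ hco.joined_B₀B₁B₂ (by linarith) hu
    have cB := h.convex hℓC hf (.inr hw) hco.joined_B₁B₂ hco.joined_not_B₁B₂ (by linarith)
      (by rw [← hu]; clear * -; grind)
    refine ⟨?_, ?_, ?_, ?_⟩
    · exact lt_or_gt_of_convex
        (fun i j i' hij hji hi hiX hiX' hj =>
          cB₁ i j i' hij hji hi hiX hiX' (.inr (.inr hj)))
        (fun i j i' hij hji hi hiX hiX' hj =>
          cB₂ i j i' hij hji hi hiX hiX' (.inr (.inr hj)))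
    · exact lt_or_gt_of_convex
        (fun i j i' hij hji hi hiX hiX' hj => cB i j i' hij hji hi hiX hiX' (.inl hj))
        (fun i j i' hij hji hi hiX hiX' hj => cA i j i' hij hji hi hiX hiX' (.inr hj))
    · exact lt_or_gt_of_convex
        (fun i j i' hij hji hi hiX hiX' hj => cA₁ i j i' hij hji hi hiX hiX' (.inl hj))
        (fun i j i' hij hji hi hiX hiX' hj => cA₂ i j i' hij hji hi hiX hiX' (.inl hj))
    · exact h.convex hℓC hf hw hco.joined_not_B₀ hco.joined_B₀ (by linarith)
        (by rw [← hu]; clear * -; grind)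
  have hxC : x ∈ V(C) := h.subset (hu ▸ .inr (.inl hx))
  obtain ⟨n, w, d, w', d', hf, hf', h0, h0', hrev⟩ := hC.exists_frame hxC
  obtain ⟨q1, q2, q3, q4⟩ := main hf h0
  rcases q2 with q2 | q2
  · exact h.exists_lt_of_frame hℓ hCG hf (h0 ▸ hx) q1 q2 q3 q4
  -- If `A₁ ∪ A₂` comes before `B₁ ∪ B₂`, the cycle is traversed in the opposite direction.
  · obtain ⟨q1', -, q3', q4'⟩ := main hf' h0'
    refine h.exists_lt_of_frame hℓ hCG hf' (h0' ▸ hx) q1' (fun i hi j hj hiB hjA => ?_) q3' q4'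
    rw [hrev _ hi] at hiB
    rw [hrev _ hj] at hjA
    have := q2 (n - j) (by lia) (n - i) (by lia) hjA hiB
    lia

end FiveBranch

/-! ### Balanced splitting of the tree and the induction on the number of terminals -/

section Transfer

variable {α β : Type*} {G C : Graph α β} {ℓ : β → ℝ} {A B X X' : Set α} {y : α} {r r' t : ℝ}

/-- A vertex at which a tree joining `A` splits into two trees, one for each of the parts `X` and
`X'` of `A`. -/
def SplitsAt (ℓ : β → ℝ) (G : Graph α β) (A : Set α) (t : ℝ) (X X' : Set α) : Prop :=
  ∃ y r r', X ∪ X' = A ∧ Disjoint X X' ∧ Joined ℓ G (insert y X) r ∧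
    Joined ℓ G (insert y X') r' ∧ r + r' ≤ t

/-- The subtree of `X` is split and its smaller part moved over to `X'`. The larger part keeps at
least half of the five or more terminals, hence at least three. If the enlarged side still has at
most two, exactly one terminal was moved. -/
lemma SplitsAt.refine (hℓ : IsLengthFunction G ℓ) (hA : A.Finite) (h : SplitsAt ℓ G A t X X')
    (hX : 5 ≤ X.ncard) (hX' : 1 ≤ X'.ncard) : ∃ P P', SplitsAt ℓ G A t P P' ∧ 3 ≤ P.ncard ∧
      X'.ncard < P'.ncard ∧ (P'.ncard ≤ 2 → P.ncard + 1 = X.ncard) := by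
  obtain ⟨y, r, r', hu, hd, hj, hj', hr⟩ := h
  have hXf : X.Finite := hA.subset (hu ▸ Set.subset_union_left)
  have hXf' : X'.Finite := hA.subset (hu ▸ Set.subset_union_right)
  have hnt : X.Nontrivial := (Set.one_lt_ncard hXf).1 (by lia)
  have main : ∀ (y' : α) (P Q : Set α) (r₀ r₁ r₂ : ℝ), Q.Nonempty → Disjoint P Q → P ∪ Q = X →
      r₀ + r₁ + r₂ ≤ r → Joined ℓ G {y, y'} r₀ → Joined ℓ G (insert y' P) r₁ →
      Joined ℓ G (insert y' Q) r₂ → Q.ncard ≤ P.ncard → ∃ P P', SplitsAt ℓ G A t P P' ∧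
      3 ≤ P.ncard ∧ X'.ncard < P'.ncard ∧ (P'.ncard ≤ 2 → P.ncard + 1 = X.ncard) := by
    intro y' P Q r₀ r₁ r₂ hQ hPQ hPQX hrr h0 h1 h2 hle
    have hPf : P.Finite := hXf.subset (hPQX ▸ Set.subset_union_left)
    have hQf : Q.Finite := hXf.subset (hPQX ▸ Set.subset_union_right)
    have hQX : Disjoint Q X' := hd.mono_left (hPQX ▸ Set.subset_union_right)
    have hPX : Disjoint P X' := hd.mono_left (hPQX ▸ Set.subset_union_left)
    have c1 := Set.ncard_union_eq hPQ hPf hQf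
    have c2 := Set.ncard_union_eq hQX hQf hXf'
    have c3 := (Set.ncard_pos hQf).2 hQ
    rw [hPQX] at c1
    refine ⟨P, Q ∪ X', ⟨y', r₁, r₂ + (r₀ + r'), ?_, ?_, h1, ?_, by linarith⟩, by lia, by lia,
      by lia⟩
    · rw [← Set.union_assoc, hPQX, hu]
    · exact Set.disjoint_union_right.2 ⟨hPQ, hPX⟩
    · have h3 := h0.union hℓ hj' (x := y) (by simp) (by simp)
      exact (h2.union hℓ h3 (x := y') (by simp) (by simp)).mono (by grind) le_rfl
  obtain ⟨y', P, Q, r₀, r₁, r₂, hP, hQ, hPQ, hPQX, hrr, h0, h1, h2⟩ := hj.exists_split hℓ hnt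
  rcases le_total Q.ncard P.ncard with hle | hle
  · exact main y' P Q r₀ r₁ r₂ hQ hPQ hPQX hrr h0 h1 h2 hle
  · exact main y' Q P r₀ r₂ r₁ hP hPQ.symm (by rw [Set.union_comm, hPQX]) (by linarith) h0 h2 h1
      hle

lemma exists_splitsAt (hℓ : IsLengthFunction G ℓ) (hA : A.Finite) (h7 : 7 ≤ A.ncard)
    (h : Joined ℓ G A t) : ∃ X X', SplitsAt ℓ G A t X X' ∧ 3 ≤ X.ncard ∧ 3 ≤ X'.ncard := by
  obtain ⟨x, hx⟩ : A.Nonempty := Set.nonempty_of_ncard_ne_zero (by lia)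
  have h1 : SplitsAt ℓ G A t (A \ {x}) {x} := by
    refine ⟨x, t, 0, Set.sdiff_union_of_subset (by simpa using hx), Set.disjoint_sdiff_left, ?_,
      joined_of_subsingleton (by simp) le_rfl, by simp⟩
    exact h.mono (by grind) le_rfl
  have c1 : (A \ {x}).ncard + 1 = A.ncard := Set.ncard_sdiff_singleton_add_one hx hA
  obtain ⟨P, P', hP, p1, p2, p3⟩ := h1.refine hℓ hA (by lia) (by simp)
  rw [Set.ncard_singleton] at p2
  -- In the remaining case `|P'| = 2`, so `|P| = |A| - 2 ≥ 5` and a second refinement is possible;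
  -- this is where seven terminals are needed.
  rcases le_or_gt 3 P'.ncard with h3 | h3
  · exact ⟨P, P', hP, p1, h3⟩
  · obtain ⟨Q, Q', hQ, q1, q2, -⟩ := hP.refine hℓ hA (by lia) (by lia)
    exact ⟨Q, Q', hQ, q1, by lia⟩

/-- Of the two parts of a first split, the larger has at least two terminals and is split again. -/
lemma Joined.exists_three_branches (hℓ : IsLengthFunction G ℓ) (hX : 3 ≤ X.ncard)
    (h : Joined ℓ G (insert y X) r) :
    ∃ (v z : α) (B₀ B₁ B₂ : Set α) (ε b₀ δ b₁ b₂ : ℝ), B₀ ∪ (B₁ ∪ B₂) = X ∧ B₀.Nonempty ∧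
      B₁.Nonempty ∧ B₂.Nonempty ∧ Disjoint B₀ (B₁ ∪ B₂) ∧ Disjoint B₁ B₂ ∧ Joined ℓ G {y, v} ε ∧
      Joined ℓ G (insert v B₀) b₀ ∧ Joined ℓ G {v, z} δ ∧ Joined ℓ G (insert z B₁) b₁ ∧
      Joined ℓ G (insert z B₂) b₂ ∧ ε + b₀ + δ + b₁ + b₂ ≤ r := by
  have hXf : X.Finite := Set.finite_of_ncard_ne_zero (by lia)
  have main : ∀ (v : α) (P Q : Set α) (r₀ r₁ r₂ : ℝ), P.Nonempty → Disjoint P Q → P ∪ Q = X →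
      r₀ + r₁ + r₂ ≤ r → Joined ℓ G {y, v} r₀ → Joined ℓ G (insert v P) r₁ →
      Joined ℓ G (insert v Q) r₂ → P.ncard ≤ Q.ncard →
      ∃ (v z : α) (B₀ B₁ B₂ : Set α) (ε b₀ δ b₁ b₂ : ℝ), B₀ ∪ (B₁ ∪ B₂) = X ∧ B₀.Nonempty ∧
      B₁.Nonempty ∧ B₂.Nonempty ∧ Disjoint B₀ (B₁ ∪ B₂) ∧ Disjoint B₁ B₂ ∧ Joined ℓ G {y, v} ε ∧
      Joined ℓ G (insert v B₀) b₀ ∧ Joined ℓ G {v, z} δ ∧ Joined ℓ G (insert z B₁) b₁ ∧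
      Joined ℓ G (insert z B₂) b₂ ∧ ε + b₀ + δ + b₁ + b₂ ≤ r := by
    intro v P Q r₀ r₁ r₂ hP hPQ hPQX hr h0 h1 h2 hle
    have hPf : P.Finite := hXf.subset (hPQX ▸ Set.subset_union_left)
    have hQf : Q.Finite := hXf.subset (hPQX ▸ Set.subset_union_right)
    have c1 := Set.ncard_union_eq hPQ hPf hQf
    rw [hPQX] at c1
    obtain ⟨z, B₁, B₂, δ, b₁, b₂, n1, n2, hd, hB, hr', j0, j1, j2⟩ :=
      h2.exists_split hℓ ((Set.one_lt_ncard hQf).1 (by lia))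
    subst hB
    exact ⟨v, z, P, B₁, B₂, r₀, r₁, δ, b₁, b₂, hPQX, hP, n1, n2, hPQ, hd, h0, h1, j0, j1, j2,
      by linarith⟩
  obtain ⟨v, P, Q, r₀, r₁, r₂, hP, hQ, hPQ, hPQX, hr, h0, h1, h2⟩ :=
    h.exists_split hℓ ((Set.one_lt_ncard hXf).1 (by lia))
  rcases le_total P.ncard Q.ncard with hle | hle
  · exact main v P Q r₀ r₁ r₂ hP hPQ hPQX hr h0 h1 h2 hle
  · exact main v Q P r₀ r₂ r₁ hQ hPQ.symm (by rw [Set.union_comm, hPQX]) (by linarith) h0 h2 h1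
      hle

lemma joined_cycle_of_ssubset (hℓ : IsLengthFunction G ℓ) (hCG : C ≤ G) (hC : IsCycle C)
    (hAC : A ⊆ V(C)) (hA : A.Finite) (h7 : 7 ≤ A.ncard)
    (htr : ∀ B r, B ⊂ A → Joined ℓ G B r → Joined ℓ C B r) (h : Joined ℓ G A t) :
    Joined ℓ C A t := by
  by_contra hnot
  obtain ⟨X, X', ⟨y, r, r', hu, hd, hj, hj', hr⟩, hX, hX'⟩ := exists_splitsAt hℓ hA h7 h
  obtain ⟨u, x, D₀, D₁, D₂, e, d₀, η, d₁, d₂, hDX, nD₀, nD₁, nD₂, dD, dD', jD, jD₀, jη, jD₁, jD₂,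
    hrD⟩ := hj.exists_three_branches hℓ hX
  obtain ⟨v, z, B₀, B₁, B₂, e', b₀, δ, b₁, b₂, hBX, nB₀, nB₁, nB₂, dB, dB', jB, jB₀, jδ, jB₁, jB₂,
    hrB⟩ := hj'.exists_three_branches hℓ hX'
  subst hDX hBX
  have juv : Joined ℓ G {u, v} (e + e') :=
    (jD.union hℓ jB (x := y) (by simp) (by simp)).mono (by grind) le_rfl
  have jDD : Joined ℓ G (insert u (D₁ ∪ D₂)) (η + (d₁ + d₂)) :=
    (jη.union hℓ (jD₁.union hℓ jD₂ (x := x) (by simp) (by simp)) (x := x) (by simp)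
      (by simp)).mono (by grind) le_rfl
  have jBB : Joined ℓ G (insert v (B₁ ∪ B₂)) (δ + (b₁ + b₂)) :=
    (jδ.union hℓ (jB₁.union hℓ jB₂ (x := z) (by simp) (by simp)) (x := z) (by simp)
      (by simp)).mono (by grind) le_rfl
  -- The six-branch tree is read as a five-branch tree in two ways, by fusing two branches on one
  -- side or on the other. The resulting strict inequalities between the two sides contradict each
  -- other.
  have f1 : FiveBranch ℓ G C A D₀ (D₁ ∪ D₂) B₀ B₁ B₂ u v z d₀ (η + (d₁ + d₂)) (e + e') b₀ δ b₁ b₂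
      t :=
    ⟨hu, hAC, nD₀, nD₁.inl, nB₀, nB₁, nB₂, dD, hd, dB, dB', jD₀, jDD, juv, jB₀, jδ, jB₁, jB₂,
      by linarith, htr, hnot⟩
  have f2 : FiveBranch ℓ G C A B₀ (B₁ ∪ B₂) D₀ D₁ D₂ v u x b₀ (δ + (b₁ + b₂)) (e + e') d₀ η d₁ d₂
      t :=
    ⟨by rw [Set.union_comm, hu], hAC, nB₀, nB₁.inl, nD₀, nD₁, nD₂, dB, hd.symm, dD, dD', jB₀, jBB,
      juv.mono (by grind) le_rfl, jD₀, jη, jD₁, jD₂, by linarith, htr, hnot⟩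
  obtain ⟨s, hs, hs'⟩ := f1.exists_lt hℓ hCG hC
  obtain ⟨s', hs₂, hs₂'⟩ := f2.exists_lt hℓ hCG hC
  rcases le_total s s' with hle | hle
  · exact hs₂' (hs.mono le_rfl hle)
  · exact hs' (hs₂.mono le_rfl hle)

theorem isFullyGeodesic_of_isGeodesic_six (hE : E(G).Finite) (hℓ : IsLengthFunction G ℓ)
    (hCG : C ≤ G) (hC : IsCycle C) (h6 : IsGeodesic ℓ 6 C G) : IsFullyGeodesic ℓ C G := by
  have main : ∀ (m : ℕ) (A : Finset α), A.card = m → A.Nonempty → (A : Set α) ⊆ V(C) → ∀ r,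
      Joined ℓ G (A : Set α) r → Joined ℓ C (A : Set α) r := by
    intro m
    induction m using Nat.strong_induction_on with
    | _ m ih =>
    intro A hm hne hAC r hj
    rcases le_or_gt m 6 with h | h
    · exact hj.of_steinerDist_eq hE hℓ hCG (by simpa using hne) hAC (h6 A hAC (hm ▸ h))
    · refine joined_cycle_of_ssubset hℓ hCG hC hAC A.finite_toSet (by simp; lia)
        (fun B s hB hBj => ?_) hj
      obtain ⟨B, rfl⟩ := (A.finite_toSet.subset hB.subset).exists_finset_coe
      rcases B.eq_empty_or_nonempty with rfl | hBne
      · exact joined_of_subsingleton (by simp) (hBj.nonneg hℓ)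
      · exact ih _ (hm ▸ Finset.card_lt_card (by simpa using hB)) B rfl hBne
          (hB.subset.trans hAC) s hBj
  intro k A hAC _
  rcases A.eq_empty_or_nonempty with rfl | hne
  · exact h6 ∅ hAC (by simp)
  · exact steinerDist_eq_of_joined hE hℓ hCG ((Finset.coe_nonempty.2 hne).mono hAC) hAC
      (main _ A rfl hne hAC)

end Transfer

namespace Tripod

/-! ### A cycle that is `5`-geodesic but not fully geodesic

The cycle `0, …, 5` together with a tree whose leaves are these six vertices: the leaves `2k` and
`2k + 1` are attached to the vertex `6 + k`, and the vertices `6, 7, 8` are attached to `9`. -/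

/-- The first end of an edge. -/
def fst (e : ℕ) : ℕ := if e < 6 then e else e - 6

/-- The second end of an edge. -/
def snd (e : ℕ) : ℕ := if e < 6 then (e + 1) % 6 else if e < 12 then e / 2 + 3 else 9

/-- The length of an edge. -/
def len (e : ℕ) : ℕ := [8, 16, 4, 16, 2, 16, 4, 4, 2, 2, 1, 1, 12, 10, 9].getD e 0

/-- The graph formed by the vertices below `m` and the edges below `k`. -/
def graph (m k : ℕ) : Graph ℕ ℕ where
  vertexSet := {x | x < m}
  IsLink e x y := e < k ∧ x < m ∧ y < m ∧ (x = fst e ∧ y = snd e ∨ x = snd e ∧ y = fst e)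
  isLink_symm e _ := ⟨fun x y h => ⟨h.1, h.2.2.1, h.2.1, by tauto⟩⟩
  eq_or_eq_of_isLink_of_isLink := by
    rintro e x y v w ⟨-, -, -, h⟩ ⟨-, -, -, h'⟩
    lia
  left_mem_of_isLink e x y h := h.2.1

lemma lt_of_mem_edgeSet {m k e : ℕ} (h : e ∈ E(graph m k)) : e < k := by
  obtain ⟨x, y, h⟩ := (graph m k).exists_isLink_of_mem_edgeSet h
  exact h.1

lemma graph_le_graph {m k m' k' : ℕ} (hm : m ≤ m') (hk : k ≤ k') : graph m k ≤ graph m' k' where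
  vertexSet_mono _ hx := lt_of_lt_of_le hx hm
  isLink_mono _ _ _ h :=
    ⟨h.1.trans_le hk, h.2.1.trans_le hm, h.2.2.1.trans_le hm, h.2.2.2⟩

lemma finite_edgeSet (m k : ℕ) : E(graph m k).Finite :=
  (Set.finite_Iio k).subset fun _ => lt_of_mem_edgeSet

lemma len_pos : ∀ e < 15, 0 < len e := by decide

lemma isLengthFunction : IsLengthFunction (graph 10 15) fun e => (len e : ℝ) := fun e he =>
  Nat.cast_pos.2 (len_pos e (lt_of_mem_edgeSet he))

lemma loopless : (graph 10 15).Loopless where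
  not_isLoopAt e x h := by
    have key : ∀ e < 15, fst e ≠ snd e := by decide
    have := key e h.1
    have := h.2.2.2
    lia

lemma isLink_cycle : ∀ i < 6, (graph 6 6).IsLink i i ((i + 1) % 6) := fun i hi =>
  ⟨hi, hi, Nat.mod_lt _ (by lia), .inl ⟨by simp [fst, hi], by simp [snd, hi]⟩⟩

lemma isCycle : IsCycle (graph 6 6) := by
  refine ⟨6, by lia, ZMod.val, ZMod.val, ZMod.val_injective 6, ZMod.val_injective 6, ?_, ?_, ?_⟩
  · ext x
    refine ⟨fun hx => ⟨(x : ZMod 6), ZMod.val_cast_of_lt hx⟩, ?_⟩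
    rintro ⟨i, rfl⟩
    exact ZMod.val_lt i
  · ext e
    refine ⟨fun he => ⟨(e : ZMod 6), ZMod.val_cast_of_lt (lt_of_mem_edgeSet he)⟩, ?_⟩
    rintro ⟨i, rfl⟩
    exact (isLink_cycle _ (ZMod.val_lt i)).edge_mem
  · intro i
    have h := isLink_cycle i.val (ZMod.val_lt i)
    rwa [show (i.val + 1) % 6 = (i + 1).val by rw [ZMod.val_add]; rfl] at h

lemma frame : Frame (graph 6 6) 6 (· % 6) id where
  pos := by lia
  wrap := rfl
  inj_vertex i hi j hj h := by simpa [Nat.mod_eq_of_lt hi, Nat.mod_eq_of_lt hj] using h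
  inj_edge i _ j _ h := h
  exists_vertex x hx := ⟨x, hx, Nat.mod_eq_of_lt hx⟩
  exists_edge e he := ⟨e, lt_of_mem_edgeSet he, rfl⟩
  link j hj := by simpa [Nat.mod_eq_of_lt hj] using isLink_cycle j hj

/-- The length of the first `k` edges of the cycle. -/
def arc (k : ℕ) : ℕ := [0, 8, 24, 28, 44, 46, 62].getD k 0

lemma prefixLength_eq : ∀ k ≤ 6, prefixLength (fun e => (len e : ℝ)) id k = arc k := by
  intro k hk
  have key : ∀ k ≤ 6, ∑ j ∈ Finset.range k, len j = arc k := by decide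
  rw [← key k hk, prefixLength]
  simp

/-- The row of `x` in the table of Steiner distances, written in base 64. -/
def row : ℕ → ℕ
  | 0 => 0xb6d9a6aaa8a2aaa9a669a492b2c9a6aaa8a2a289a6618410b2c9a6aaa8a2aaa9a669a49271c71c71c71c618618208000
  | 1 => 0xb66b66aa6aa6aa6aa669a69ab26b26aa6aa6a26a26618618b24b24aa4aa4aa4aa469a69a714714714714610610200200
  | 2 => 0xb66996b66996aa6996aa6996b26996b26996a26996a26996b24994b24994aa4994aa4994714704714704610600610600
  | 3 => 0xb66996aa6892b66996aa6892b26996aa6892b26996aa6892b24994aa4890b24994aa4890714704714700714704714700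
  | 4 => 0xb66996aa6892aa699669a482b66996aa6892aa699669a482b24994aa4890aa499469a480b24994aa4890aa499469a480
  | 5 => 0xb66996aa6892aa699669a482b26996aa6892a26996618400b66996aa6892aa699669a482b26996aa6892a26996618400
  | 6 => 0xb69a65aa79a3aa79e369a596b28a24aa69a2a269a2618514b28a24aa69a2aa69a269a596718718718718614614204100
  | 7 => 0xb66996ae6914ae6996a65914b26996aa6914aa6996a24914b24994aa4912aa4994a24912714704714702692682692680
  | 8 => 0xb66996aa6892aa699669a482b26996aa6892a66996659441b25995aa5891aa599569a481ae5995a65891a65955659440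
  | 9 => 0xb69a59ae79d7ae79d77db6cbb28a18aa6996aa699679a68ab28a18aa6996aa699679a68a89e78e81c70c81c70c510400
  | _ => 0

/-- The Steiner distance in the graph of the vertex `x` together with those vertices of the cycle
that correspond to the binary digits of `m`. -/
def dist (x m : ℕ) : ℕ := row x / 64 ^ m % 64

/-- This check and the three after it mirror the constructors of `RootedTree`. Together they make
the table a lower bound for tree lengths, which is all that is used of it. -/
lemma dist_lor : ∀ x < 10, ∀ m < 64, ∀ m' < 64, m &&& m' = 0 →
    dist x (m ||| m') ≤ dist x m + dist x m' := by
  decide +kernel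

lemma dist_edge : ∀ e < 15, ∀ m < 64,
    dist (fst e) m ≤ dist (snd e) m + len e ∧ dist (snd e) m ≤ dist (fst e) m + len e := by
  decide +kernel

lemma dist_zero : ∀ x < 10, dist x 0 = 0 := by
  decide +kernel

lemma dist_self : ∀ x < 6, dist x (2 ^ x) = 0 := by
  decide +kernel

-- The mask 63, all six vertices, is excluded: only proper subsets are joined by an arc as short as
-- the table's bound. The second alternative is an arc through the base point, of length `62 - (arc
-- b - arc a)`.
set_option synthInstance.maxSize 1000 in
lemma exists_arc : ∀ m < 63, ∀ x < 6, m.testBit x →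
    ∃ a ∈ Finset.range 7, ∃ b ∈ Finset.range 7, a ≤ b ∧
    ((∀ i < 6, m.testBit i → a ≤ i ∧ i ≤ b) ∧ arc b ≤ arc a + dist x m ∨
      (∀ i < 6, m.testBit i → i ≤ a ∨ b ≤ i) ∧ 62 + arc a ≤ arc b + dist x m) := by
  decide +kernel

open Classical in
/-- The number whose binary digits describe a set of vertices of the cycle. -/
noncomputable def mask (B : Set ℕ) : ℕ := Nat.ofBits fun i : Fin 6 => decide ((i : ℕ) ∈ B)

lemma mask_lt (B : Set ℕ) : mask B < 64 := Nat.ofBits_lt_two_pow _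

lemma testBit_mask (B : Set ℕ) (i : ℕ) : (mask B).testBit i ↔ i < 6 ∧ i ∈ B := by
  rcases lt_or_ge i 6 with h | h
  · simp [mask, Nat.testBit_ofBits_lt _ _ h, h]
  · simp [mask, Nat.testBit_ofBits_ge _ _ h, h]

lemma mask_union (B B' : Set ℕ) : mask (B ∪ B') = mask B ||| mask B' := by
  refine Nat.eq_of_testBit_eq fun i => ?_
  rw [Bool.eq_iff_iff, Nat.testBit_lor, Bool.or_eq_true]
  simp only [testBit_mask, Set.mem_union]
  tauto

lemma mask_land {B B' : Set ℕ} (h : Disjoint B B') : mask B &&& mask B' = 0 := by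
  refine Nat.eq_of_testBit_eq fun i => ?_
  rw [Bool.eq_iff_iff, Nat.testBit_land, Bool.and_eq_true]
  simp only [testBit_mask, Nat.zero_testBit]
  have : i ∈ B → i ∉ B' := fun hb => Set.disjoint_left.1 h hb
  simp only [Bool.false_eq_true, iff_false]
  tauto

lemma mask_singleton {x : ℕ} (hx : x < 6) : mask {x} = 2 ^ x := by
  refine Nat.eq_of_testBit_eq fun i => ?_
  rw [Bool.eq_iff_iff, testBit_mask, Nat.testBit_two_pow]
  simp
  lia

lemma mask_eq_zero {B : Set ℕ} (h : ∀ i < 6, i ∉ B) : mask B = 0 := by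
  refine Nat.eq_of_testBit_eq fun i => ?_
  rw [Bool.eq_iff_iff, testBit_mask, Nat.zero_testBit]
  simpa using h i

lemma dist_le {x : ℕ} {B : Set ℕ} {r : ℝ}
    (h : RootedTree (fun e => (len e : ℝ)) (graph 10 15) x B r) (hx : x < 10) :
    (dist x (mask B) : ℝ) ≤ r := by
  induction h with
  | nil x => simp [mask_eq_zero, dist_zero x hx]
  | self x =>
    rcases lt_or_ge x 6 with h | h
    · simp [mask_singleton h, dist_self x h]
    · simp [mask_eq_zero (B := {x}) fun i hi => by simp; lia, dist_zero x hx]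
  | @step x y B r e hl _ ih =>
    have h1 := ih hl.2.2.1
    have h2 := dist_edge e hl.1 _ (mask_lt B)
    have h3 : dist x (mask B) ≤ dist y (mask B) + len e := by
      rcases hl.2.2.2 with ⟨rfl, rfl⟩ | ⟨rfl, rfl⟩
      exacts [h2.1, h2.2]
    have h4 : (dist x (mask B) : ℝ) ≤ dist y (mask B) + len e := by exact_mod_cast h3
    linarith
  | @merge x B B' r r' hd _ _ ih ih' =>
    have h1 := ih hx
    have h2 := ih' hx
    have h3 := dist_lor x hx _ (mask_lt B) _ (mask_lt B') (mask_land hd)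
    rw [mask_union]
    have h4 : (dist x (mask B ||| mask B') : ℝ) ≤ dist x (mask B) + dist x (mask B') := by
      exact_mod_cast h3
    linarith

lemma isGeodesic : IsGeodesic (fun e => (len e : ℝ)) 5 (graph 6 6) (graph 10 15) := by
  intro A hA hcard
  have hCG : graph 6 6 ≤ graph 10 15 := graph_le_graph (by lia) (by lia)
  refine steinerDist_eq_of_joined (finite_edgeSet _ _) isLengthFunction hCG
    ⟨0, show 0 < 6 by lia⟩ hA fun r hj => ?_
  rcases A.eq_empty_or_nonempty with rfl | ⟨x, hx⟩
  · exact joined_of_subsingleton (by simp) (hj.nonneg isLengthFunction)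
  have hx6 : x < 6 := hA hx
  rw [← Set.insert_eq_of_mem (Finset.mem_coe.2 hx)] at hj
  obtain ⟨r', hr', ht⟩ := hj.exists_rootedTree isLengthFunction
  have hd := (dist_le ht (by lia)).trans hr'
  -- The bound of five on the size of `A` enters here.
  have hm : mask A ≠ 63 := by
    intro hm
    have hsub : Finset.range 6 ⊆ A := fun i hi => by
      have hi' := Finset.mem_range.1 hi
      have key : ∀ i < 6, Nat.testBit 63 i := by decide
      have := key i hi'
      rw [← hm, testBit_mask] at this
      exact this.2
    have := Finset.card_le_card hsub
    simp at this
    lia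
  have hm' := mask_lt (A : Set ℕ)
  obtain ⟨a, ha, b, hb, hab, ⟨h1, h2⟩ | ⟨h1, h2⟩⟩ :=
    exists_arc (mask A) (by lia) x hx6 ((testBit_mask _ _).2 ⟨hx6, hx⟩)
  · rw [Finset.mem_range] at ha hb
    refine (frame.joined_arc (x := a) (y := b) hab (by lia) fun i hi => ?_).mono le_rfl ?_
    · have := h1 i (hA hi) ((testBit_mask _ _).2 ⟨hA hi, hi⟩)
      exact ⟨i, this.1, this.2, Nat.mod_eq_of_lt (hA hi)⟩
    · rw [prefixLength_eq b (by lia), prefixLength_eq a (by lia)]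
      have : (arc b : ℝ) ≤ arc a + dist x (mask A) := by exact_mod_cast h2
      linarith
  · rw [Finset.mem_range] at ha hb
    refine (frame.joined_compl_arc (x := a) (y := b) hab (by lia) fun i hi => ?_).mono le_rfl ?_
    · have := h1 i (hA hi) ((testBit_mask _ _).2 ⟨hA hi, hi⟩)
      exact ⟨i, (show i < 6 from hA hi).le, this, Nat.mod_eq_of_lt (hA hi)⟩
    · rw [prefixLength_eq b (by lia), prefixLength_eq a (by lia), prefixLength_eq 6 le_rfl]
      have : (62 + arc a : ℝ) ≤ arc b + dist x (mask A) := by exact_mod_cast h2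
      have h6 : (arc 6 : ℝ) = 62 := by norm_num [arc]
      linarith

lemma joined_tree :
    Joined (fun e => (len e : ℝ)) (graph 10 15) ((Finset.range 6 : Finset ℕ) : Set ℕ) 45 := by
  have hlink : ∀ e, 6 ≤ e → e < 15 → (graph 10 15).IsLink e (fst e) (snd e) := fun e he he' =>
    ⟨he', by simp only [fst]; split_ifs <;> lia, by simp only [snd]; split_ifs <;> lia,
      .inl ⟨rfl, rfl⟩⟩
  have key : ∀ a ∈ ((Finset.range 6 : Finset ℕ) : Set ℕ),
      Reach (graph 10 15) (Finset.Ico 6 15) a 9 := by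
    intro a ha
    have ha : a < 6 := by simpa using ha
    have h1 := hlink (a + 6) (by lia) (by lia)
    have h2 := hlink (a / 2 + 12) (by lia) (by lia)
    rw [show fst (a + 6) = a by simp [fst]] at h1
    rw [show fst (a / 2 + 12) = snd (a + 6) by
        simp only [fst, snd]; split_ifs <;> lia,
      show snd (a / 2 + 12) = 9 by simp only [snd]; split_ifs <;> lia] at h2
    exact (Reach.of_isLink (by simp; lia) h1).trans (.of_isLink (by simp; lia) h2)
  refine ⟨Finset.Ico 6 15, fun e he => ?_, fun a ha b hb => (key a ha).trans (key b hb).symm, ?_⟩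
  · have := Finset.mem_Ico.1 (Finset.mem_coe.1 he)
    exact (hlink e this.1 this.2).edge_mem
  · have : ∑ e ∈ Finset.Ico 6 15, len e = 45 := by decide
    change ∑ e ∈ Finset.Ico 6 15, (len e : ℝ) ≤ 45
    exact_mod_cast this.le

lemma not_isFullyGeodesic :
    ¬ IsFullyGeodesic (fun e => (len e : ℝ)) (graph 6 6) (graph 10 15) := by
  intro h
  have hCG : graph 6 6 ≤ graph 10 15 := graph_le_graph (by lia) (by lia)
  have hsub : ((Finset.range 6 : Finset ℕ) : Set ℕ) ⊆ V(graph 6 6) := fun i hi => by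
    simpa [graph] using hi
  have hj := joined_tree.of_steinerDist_eq (finite_edgeSet _ _) isLengthFunction hCG (by simp) hsub
    (h 6 (Finset.range 6) hsub (by simp))
  obtain ⟨j, hj6, hcut⟩ := frame.exists_cut (isLengthFunction.of_le hCG) hj
  -- Both ends of the omitted edge are terminals, so the rest of the cycle would cost at most 45.
  -- The longest edge has length 16, which leaves at least 46.
  have h1 := (hcut j (j + 1) (by lia) (by lia) (by simp; lia) (by simp; lia)).1 le_rfl (by lia)
  rw [prefixLength_eq _ (by lia), prefixLength_eq _ (by lia), prefixLength_eq _ (by lia)] at h1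
  have key : ∀ j < 6, 45 + arc (j + 1) < arc 6 + arc j := by decide
  have h2 : (45 + arc (j + 1) : ℝ) < arc 6 + arc j := by exact_mod_cast key j hj6
  linarith

end Tripod

end SteinerGeodesic

theorem theorem2 :
    (∀ {α : Type*} {β : Type*} (G C : Graph α β) (ℓ : β → ℝ),
      V(G).Finite → E(G).Finite → G.Loopless →
      SteinerGeodesic.IsLengthFunction G ℓ →
      C ≤ G → SteinerGeodesic.IsCycle C →
      SteinerGeodesic.IsGeodesic ℓ 6 C G →
      SteinerGeodesic.IsFullyGeodesic ℓ C G) ∧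
    (∀ k : ℕ, k < 6 →
      ∃ (G C : Graph ℕ ℕ) (ℓ : ℕ → ℝ),
        V(G).Finite ∧ E(G).Finite ∧ G.Loopless ∧
        SteinerGeodesic.IsLengthFunction G ℓ ∧
        C ≤ G ∧ SteinerGeodesic.IsCycle C ∧
        SteinerGeodesic.IsGeodesic ℓ k C G ∧
        ¬ SteinerGeodesic.IsFullyGeodesic ℓ C G) := by
  open SteinerGeodesic in
  refine ⟨fun G C ℓ _ hE _ hℓ hCG hC h6 =>
    isFullyGeodesic_of_isGeodesic_six hE hℓ hCG hC h6, fun k hk => ?_⟩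
  open SteinerGeodesic in
  exact ⟨Tripod.graph 10 15, Tripod.graph 6 6, fun e => Tripod.len e, Set.finite_Iio 10,
    Tripod.finite_edgeSet _ _, Tripod.loopless, Tripod.isLengthFunction,
    Tripod.graph_le_graph (by lia) (by lia), Tripod.isCycle,
    fun A hA hc => Tripod.isGeodesic A hA (by lia), Tripod.not_isFullyGeodesic⟩
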